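/- **Model.** $k$ anonymous stations share a channel; time is divided into synchronous rounds. Initially all stations sleep. An adaptive adversary decides, in every round and from the complete record of all previous rounds (but without knowledge of present or future random choices), which sleeping stations to activate; the round of activation is round $0$ of the station's local clock, and the station takes part from the next round on. In each round an active station transmits a message or listens. If exactly one station transmits, it gets an acknowledgement and all other active stations receive its message; otherwise (silence or collision) nobody perceives anything. A message is a data packet or one of the control messages $\langle$D mode$\rangle$ and $\langle$anybody?$\rangle$. **Protocol AdaptiveNoK** (with a constant $q>0$). All random choices are independent. 1. *Waiting.* An activated station listens in consecutive blocks of four rounds. If it receives $\langle$anybody?$\rangle$, it leaves this loop at the end of that round; it also leaves it at the end of a block in which it received no message. Otherwise it goes on with the next block. 2. *Leader election (DecreaseSlowly).* Having left the loop, the station transmits its packet in its $i$-th subsequent round ($i=0,1,2,\dots$) with probability $q/(2q+i)$, until a transmission succeeds on the channel. If the successful transmission is its own, it becomes the leader; otherwise it becomes a non-leader. In both cases it enters dissemination mode, whose rounds are counted by $tc$, the round of the successful transmission being $tc=0$. 3. *Dissemination.* In rounds with $tc$ odd the non-leaders execute the protocol SUniform, and the leader is silent. In rounds with $tc=2^x$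 for an integer $x\ge 2$ the leader and all non-leaders that have not yet switched off transmit $\langle$anybody?$\rangle$; if the leader gets an acknowledgement, it switches off permanently. In all other rounds with $tc \geq 2$ even, the leader alone transmits $\langle$D mode$\rangle$. 4. *SUniform (sawtooth back-off).* For $i=0,1,2,\dots$ and, within this, for $j=i,i-1,\dots,0$: a window of $2^j$ slots (consecutive odd rounds) is run, in which each participating station transmits its packet in one slot chosen uniformly at random. A station switches off permanently once it gets an acknowledgement for its packet here. **Theorem.** The expected total number of broadcast attempts (transmissions of packets and of control messages by all stations, successful or not) during the execution of AdaptiveNoK is $O(k\log^2 k)$, even against an adaptive adversary. That is, for every $q>0$ there is a constant $C$, depending only on $q$, such that for every $k\ge 2$ and every adaptive adversary with $k$ stations, this expectation is at most $C\,k\log^2 k$. -/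

import Mathlib

open MeasureTheory
open scoped ENNReal

/-- What a station may put on the channel in a round: its data packet, or one of two
one-bit control messages. -/
inductive Message where
  | packet
  /-- `<D mode>` -/
  | dmode
  /-- `<is there anybody out there?>` -/
  | anybody

/-- What a station perceives in a round. Without collision detection, silence, collisions and
one's own unsuccessful transmissions are all perceived as `nothing`. -/
inductive Feedback where
  | nothing
  /-- the station was the only transmitter -/
  | ack
  /-- the station listened, and exactly one (other) station transmitted -/
  | received (m : Message)

/-- Internal state of the sawtooth back-off protocol `SUniform`. The outer loop runs through
`outer = 0, 1, 2, …`; the inner loop runs through windows of sizes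
`2 ^ outer, 2 ^ (outer - 1), …, 2, 1`; the current window has size `2 ^ inner`, its current slot
is `pos`, and `choice` is the slot chosen for transmission in it. -/
structure Saw where
  outer : ℕ
  inner : ℕ
  pos : ℕ
  choice : ℕ

namespace Saw

def start : Saw := ⟨0, 0, 0, 0⟩

/-- At the first slot of a window the transmission slot of this window is chosen
(uniformly in `{0, …, 2 ^ inner - 1}` if `u` is uniform in `[0,1]`). -/
noncomputable def draw (s : Saw) (u : unitInterval) : Saw :=
  if s.pos = 0 then { s with choice := ⌊(u : ℝ) * 2 ^ s.inner⌋₊ } else s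

/-- Move to the next slot. -/
def advance (s : Saw) : Saw :=
  if s.pos + 1 < 2 ^ s.inner then { s with pos := s.pos + 1 }
  else if 0 < s.inner then { s with inner := s.inner - 1, pos := 0 }
  else { s with outer := s.outer + 1, inner := s.outer + 1, pos := 0 }

end Saw

/-- Local state of a station. -/
inductive Station where
  /-- not yet activated -/
  | asleep
  /-- in the initial listening loop; `j < 4` rounds of the current block of four rounds have
  passed, and `heard` tells whether a message has been received in them -/
  | wait (j : ℕ) (heard : Bool)
  /-- leader election mode: iteration number `i` of `DecreaseSlowly` is about to be executed -/
  | elect (i : ℕ)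
  /-- leader in dissemination mode; the coming round has number `tc`
  (the round of the election had number `0`) -/
  | lead (tc : ℕ)
  /-- non-leader in dissemination mode; the coming round has number `tc` -/
  | member (tc : ℕ) (s : Saw)
  /-- switched off forever -/
  | off

/-- The rounds of a dissemination mode in which all its participants transmit
`<is there anybody out there?>`. -/
def IsWhite (tc : ℕ) : Prop := ∃ x : ℕ, 2 ≤ x ∧ tc = 2 ^ x

namespace Station

open scoped Classical in
/-- The message (if any) a station transmits in the coming round, when its private random number
for this round is `u`; `q` is the constant of `DecreaseSlowly`. -/
noncomputable def send (q : ℝ) (u : unitInterval) : Station → Option Message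
  | asleep => none
  | wait _ _ => none
  | elect i => if (u : ℝ) < q / (2 * q + i) then some .packet else none
  | lead tc =>
      if Odd tc then none
      else if IsWhite tc then some .anybody
      else some .dmode
  | member tc s =>
      if Odd tc then (if (s.draw u).pos = (s.draw u).choice then some .packet else none)
      else if IsWhite tc then some .anybody
      else none
  | off => none

open scoped Classical in
/-- The state of an active station after a round in which its random number was `u` and it
perceived the given feedback. -/
noncomputable def next (u : unitInterval) : Station → Feedback → Station
  | asleep, _ => asleep
  | wait _ _, .received .anybody => elect 0
  | wait j _, .received _ => if j + 1 < 4 then wait (j + 1) true else wait 0 false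
  | wait j heard, _ =>
      if j + 1 < 4 then wait (j + 1) heard
      else if heard then wait 0 false
      else elect 0
  | elect _, .ack => lead 1
  | elect _, .received _ => member 1 Saw.start
  | elect i, .nothing => elect (i + 1)
  | lead tc, .ack => if IsWhite tc then off else lead (tc + 1)
  | lead tc, _ => lead (tc + 1)
  | member tc s, .ack => if Odd tc then off else member (tc + 1) s
  | member tc s, _ => member (tc + 1) (if Odd tc then (s.draw u).advance else s)
  | off, _ => off

end Station

section Channel

variable {k : ℕ}

/-- The stations that transmit in a round, given the messages sent by all stations. -/
def transmitters (sent : Fin k → Option Message) : Finset (Fin k) :=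
  Finset.univ.filter fun v => (sent v).isSome

/-- The message that gets through: there is one iff exactly one station transmits. -/
def channel (sent : Fin k → Option Message) : Option Message :=
  if (transmitters sent).card = 1 then (List.finRange k).findSome? sent else none

/-- Perception of station `v`. -/
def feedback (sent : Fin k → Option Message) (v : Fin k) : Feedback :=
  match channel sent with
  | none => .nothing
  | some m => if (sent v).isSome then .ack else .received m

/-- The record of one round: the messages sent in it and the states of all stations at its end. -/
structure Snapshot (k : ℕ) where
  sent : Fin k → Option Message
  state : Fin k → Station

/-- An adaptive adversary: from the complete record of all previous rounds (last round first) it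
decides which stations are activated in the current round. -/
abbrev Adversary (k : ℕ) := List (Snapshot k) → Finset (Fin k)

/-- States at the end of a recorded history; at the beginning all stations are sleeping. -/
def currentState : List (Snapshot k) → Fin k → Station
  | [] => fun _ => .asleep
  | r :: _ => r.state

/-- One round of the system after the history `h`, with random numbers `u v` for the stations `v`.
The round in which a station is activated is round `0` of its local clock; it takes part in the
communication from the next round on. -/
noncomputable def playRound (q : ℝ) (adv : Adversary k) (u : Fin k → unitInterval)
    (h : List (Snapshot k)) : Snapshot k :=
  let sent : Fin k → Option Message := fun v => (currentState h v).send q (u v)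
  { sent := sent
    state := fun v =>
      match currentState h v with
      | .asleep => if v ∈ adv h then .wait 0 false else .asleep
      | s => s.next (u v) (feedback sent v) }

/-- The history before round `t`, if `ω t v` is the random number of station `v` in round `t`. -/
noncomputable def history (q : ℝ) (adv : Adversary k) (ω : ℕ → Fin k → unitInterval) :
    ℕ → List (Snapshot k)
  | 0 => []
  | t + 1 => playRound q adv (ω t) (history q adv ω t) :: history q adv ω t

/-- The number of broadcast attempts (of packets and of control messages) in round `t`. -/
noncomputable def attempts (q : ℝ) (adv : Adversary k) (ω : ℕ → Fin k → unitInterval)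
    (t : ℕ) : ℕ :=
  (transmitters (playRound q adv (ω t) (history q adv ω t)).sent).card

/-- The total number of broadcast attempts during the (infinite) execution. -/
noncomputable def totalAttempts (q : ℝ) (adv : Adversary k)
    (ω : ℕ → Fin k → unitInterval) : ℝ≥0∞ :=
  ∑' t, (attempts q adv ω t : ℝ≥0∞)

/-- The law of the random numbers: all of them are independent and uniform in `[0,1]`. -/
noncomputable def coinLaw (k : ℕ) : Measure (ℕ → Fin k → unitInterval) :=
  Measure.infinitePi fun _ => Measure.pi fun _ => volume

/-- The expected total number of broadcast attempts of `AdaptiveNoK` against `adv`. -/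
noncomputable def expectedAttempts (q : ℝ) (adv : Adversary k) : ℝ≥0∞ :=
  ∫⁻ ω, totalAttempts q adv ω ∂(coinLaw k)

end Channel

/-! The proof is a potential argument. `potential` maps a configuration of station states to a bound
on the expected number of transmissions still to come. `lintegral_step_le` shows, for every
configuration and every set of activated stations, that the transmissions of a round plus the new
potential are in expectation at most the old potential. The adversary's decision is a function of
the history, and the history is independent of the coins of the current round
(`map_history_prodMk`), so adaptivity is harmless. Telescoping (`expectedAttempts_le_of_potential`)
leaves the potential of the all-asleep configuration: `k` weights, each `O(log² k)`.

Only two kinds of configurations arise, `IsElection` and `IsDissemination`. Among any four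
consecutive rounds of a dissemination mode one has `tc % 4 = 2`; there the leader alone transmits
and is heard, so no waiting station finds a block silent (`QuietFor.lt_three`). The query
`<anybody?>` gets through only when all non-leaders are off. All other configurations have potential
`∞`, being an infimum over an empty family, so the step inequality needs no separate proof that the
invariants persist.

Election. Let `P` be the expected number of transmissions in a round and `R` the probability of
exactly one. Then `P - P² ≤ R`, so `P ≤ 2R` while `P ≤ 1/2`. A larger `P` is dominated by stations
in iterations `i < N`, since all later ones together contribute at most `1/4`. Hence `P ≤ 2C + 2R`,
where `C` counts only iterations below `N`. Each station prepays `2C` through `electReserve`, a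
harmonic sum of order `log k`, and a success releases the `2` that pays for `2R`.

Dissemination. A success also releases `c = 100 + X + K (K + 113)` per participant, which finances
the mode (`phaseCost_start_le`). In pass `o` of the sawtooth a participant sends at most `o + 1`
packets, and `K = O(log k)` passes are reserved; this gives `log² k`. If `R` stations meet a window
of size `2 ^ j > 2R`, at most `R² / 2 ^ j` of them are expected to fail, so the ratio of stations to
window size does not grow in expectation. The capped ratio in `windowCost` therefore bounds the
expected price of a further pass (`lintegral_slotCost_le`). The leader's messages are charged to
slots at a constant rate. The wait for the last white round is at most of the order of the time
elapsed, and `leadCost` saves for it. Each participant saves one transmission for every white round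
`2 ^ x` with `x < X`; in later ones `tc ≥ k`, and the drop of `leadCost` covers everybody. -/

/-! ### Cost accounting for the sawtooth back-off. -/

/-- The cost per participant that is set aside for the sawtooth passes `o, …, K - 1`. -/
def passReserve (K o : ℕ) : ℕ := ∑ i ∈ Finset.Ico o K, (i + 113)

/-- Bound on the expected remaining cost when `R` stations are about to start the window of size
`2 ^ j` in pass `o` of the sawtooth back-off. -/
def windowCost (K o j R : ℕ) : ℕ :=
  if R = 0 then 0
  else 7 * (2 ^ (j + 1) - 1) + R * (j + 1) + 28 * min (2 ^ (o + 1)) (R * 2 ^ (o + 2 - j))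
    + R * passReserve K (o + 1)

/-- The cost bound at the window that follows the window of size `2 ^ j` in pass `o`. -/
def nextWindowCost (K o j R : ℕ) : ℕ :=
  if 0 < j then windowCost K o (j - 1) R else windowCost K (o + 1) (o + 1) R

/-- The stations that will still be active at the end of the current window of size `2 ^ j`, if
`M` are the stations active before slot `p` and `c` gives their transmission slots. -/
def survivors {k : ℕ} (j p : ℕ) (M : Finset (Fin k)) (c : Fin k → ℕ) : Finset (Fin k) :=
  M.filter fun v => ¬ (p ≤ c v ∧ c v < 2 ^ j ∧ ∀ w ∈ M, c w = c v → w = v)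

/-- Cost bound before slot `p` of a window in which the transmission slots `c` are known. -/
def slotCost {k : ℕ} (K o j p : ℕ) (M : Finset (Fin k)) (c : Fin k → ℕ) : ℕ :=
  (if M = ∅ then 0 else 7 * (2 ^ j - p)) + (M.filter fun v => p ≤ c v).card
    + nextWindowCost K o j (survivors j p M c).card

/-- Cost bound of the sawtooth back-off before a slot is executed. -/
def sawCost {k : ℕ} (K o j p : ℕ) (M : Finset (Fin k)) (c : Fin k → ℕ) : ℕ :=
  if p = 0 then windowCost K o j M.card else slotCost K o j p M c

@[simp] lemma windowCost_zero (K o j : ℕ) : windowCost K o j 0 = 0 := by simp [windowCost]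

@[simp] lemma nextWindowCost_zero (K o j : ℕ) : nextWindowCost K o j 0 = 0 := by
  simp [nextWindowCost]

lemma survivors_subset {k : ℕ} (j p : ℕ) (M : Finset (Fin k)) (c : Fin k → ℕ) :
    survivors j p M c ⊆ M := Finset.filter_subset _ _

@[simp] lemma slotCost_empty {k : ℕ} (K o j p : ℕ) (c : Fin k → ℕ) :
    slotCost K o j p ∅ c = 0 := by
  simp [slotCost, survivors]

@[simp] lemma sawCost_empty {k : ℕ} (K o j p : ℕ) (c : Fin k → ℕ) :
    sawCost K o j p ∅ c = 0 := by
  simp [sawCost]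

lemma slotCost_congr {k : ℕ} (K o j p : ℕ) {M : Finset (Fin k)} {c c' : Fin k → ℕ}
    (h : ∀ v ∈ M, c v = c' v) : slotCost K o j p M c = slotCost K o j p M c' := by
  have h1 : M.filter (fun v => p ≤ c v) = M.filter fun v => p ≤ c' v :=
    Finset.filter_congr fun v hv => by rw [h v hv]
  have h2 : survivors j p M c = survivors j p M c' := by
    refine Finset.filter_congr fun v hv => ?_
    rw [h v hv]
    refine not_congr (and_congr_right fun _ => and_congr_right fun _ =>
      forall_congr' fun w => forall_congr' fun hw => ?_)
    rw [h w hw]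
  simp only [slotCost, h1, h2]

lemma sawCost_congr {k : ℕ} (K o j p : ℕ) {M : Finset (Fin k)} {c c' : Fin k → ℕ}
    (h : ∀ v ∈ M, c v = c' v) : sawCost K o j p M c = sawCost K o j p M c' := by
  rw [sawCost, sawCost, slotCost_congr K o j p h]

/-- The stations that remain after slot `p`, in which the stations with `c v = p` transmit. -/
def afterSlot {k : ℕ} (p : ℕ) (M : Finset (Fin k)) (c : Fin k → ℕ) : Finset (Fin k) :=
  if (M.filter fun v => c v = p).card = 1 then M \ M.filter fun v => c v = p else M

lemma afterSlot_subset {k : ℕ} (p : ℕ) (M : Finset (Fin k)) (c : Fin k → ℕ) :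
    afterSlot p M c ⊆ M := by
  unfold afterSlot; split_ifs
  · exact Finset.sdiff_subset
  · exact subset_rfl

lemma mem_afterSlot {k : ℕ} {p : ℕ} {M : Finset (Fin k)} {c : Fin k → ℕ} {v : Fin k} :
    v ∈ afterSlot p M c ↔ v ∈ M ∧ ¬ (c v = p ∧ ∀ w ∈ M, c w = c v → w = v) := by
  unfold afterSlot
  split_ifs with h
  · obtain ⟨x, hx⟩ := Finset.card_eq_one.1 h
    have hx' : ∀ w, (w ∈ M ∧ c w = p) ↔ w = x := fun w => by
      simpa using Finset.ext_iff.1 hx w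
    simp only [Finset.mem_sdiff, Finset.mem_filter]
    constructor
    · rintro ⟨h1, h2⟩
      exact ⟨h1, fun h3 => h2 ⟨h1, h3.1⟩⟩
    · rintro ⟨h1, h2⟩
      refine ⟨h1, fun h3 => h2 ⟨h3.2, fun w hw hwv => ?_⟩⟩
      rw [(hx' v).1 h3, ← hx' w]
      exact ⟨hw, hwv.trans h3.2⟩
  · refine ⟨fun h1 => ⟨h1, fun h2 => h ?_⟩, fun h1 => h1.1⟩
    refine Finset.card_eq_one.2 ⟨v, ?_⟩
    ext w
    simp only [Finset.mem_filter, Finset.mem_singleton]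
    constructor
    · rintro ⟨hw, hwp⟩
      exact h2.2 w hw (hwp.trans h2.1.symm)
    · rintro rfl
      exact ⟨h1, h2.1⟩

/-- A success in slot `p` removes only a station whose slot is `p`, so it cannot affect which of the
later slots are singly occupied. -/
lemma survivors_afterSlot {k : ℕ} (j p : ℕ) (M : Finset (Fin k)) (c : Fin k → ℕ)
    (hp : p < 2 ^ j) :
    survivors j (p + 1) (afterSlot p M c) c = survivors j p M c := by
  ext v
  simp only [survivors, Finset.mem_filter, mem_afterSlot]
  constructor
  · rintro ⟨⟨h1, h2⟩, h3⟩
    refine ⟨h1, fun ⟨h4, h5, h6⟩ => ?_⟩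
    rcases h4.eq_or_lt with h4 | h4
    · exact h2 ⟨h4.symm, h6⟩
    · exact h3 ⟨h4, h5, fun w hw => h6 w hw.1⟩
  · rintro ⟨h1, h2⟩
    refine ⟨⟨h1, fun h3 => h2 ⟨h3.1.ge, h3.1 ▸ hp, h3.2⟩⟩, fun ⟨h4, h5, h6⟩ => ?_⟩
    refine h2 ⟨by omega, h5, fun w hw hwv => h6 w ⟨hw, fun h7 => ?_⟩ hwv⟩
    omega

lemma survivors_last {k : ℕ} (j p : ℕ) (M : Finset (Fin k)) (c : Fin k → ℕ)
    (hp : p + 1 = 2 ^ j) : survivors j p M c = afterSlot p M c := by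
  ext v
  simp only [survivors, Finset.mem_filter, mem_afterSlot]
  refine and_congr_right fun _ => not_congr ⟨fun h => ⟨by omega, h.2.2⟩, fun h => ⟨by omega, by omega, h.2⟩⟩

/-- A slot stands for an odd round and the even round after it. Of its `7` units, `3` cover the
growth of `leadCost` in the odd round and `4` are stored for the even round. -/
lemma card_slot_add_sawCost_le {k : ℕ} (K o j p x : ℕ) (M : Finset (Fin k)) (c : Fin k → ℕ)
    (hp : p < 2 ^ j) (hM : M.Nonempty) :
    (M.filter fun v => c v = p).card + 7 +
      sawCost K (Saw.advance ⟨o, j, p, x⟩).outer (Saw.advance ⟨o, j, p, x⟩).inner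
        (Saw.advance ⟨o, j, p, x⟩).pos (afterSlot p M c) c ≤ slotCost K o j p M c := by
  have hM' : M ≠ ∅ := hM.ne_empty
  have hcard : (M.filter fun v => c v = p).card + (M.filter fun v => p + 1 ≤ c v).card
      = (M.filter fun v => p ≤ c v).card := by
    rw [← Finset.card_union_of_disjoint]
    · congr 1
      ext v
      simp only [Finset.mem_union, Finset.mem_filter, ← and_or_left]
      refine and_congr_right fun _ => ?_
      omega
    · refine Finset.disjoint_filter.2 fun v _ h => ?_
      omega
  have hsub : ((afterSlot p M c).filter fun v => p + 1 ≤ c v).card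
      ≤ (M.filter fun v => p + 1 ≤ c v).card :=
    Finset.card_le_card (Finset.filter_subset_filter _ (afterSlot_subset p M c))
  unfold Saw.advance
  by_cases h1 : p + 1 < 2 ^ j
  · simp only [h1, if_true, sawCost, Nat.add_eq_zero_iff, one_ne_zero, and_false, if_false,
      slotCost, survivors_afterSlot j p M c hp, hM']
    have : (if afterSlot p M c = ∅ then 0 else 7 * (2 ^ j - (p + 1))) ≤ 7 * (2 ^ j - (p + 1)) := by
      split_ifs <;> omega
    omega
  · have h2 : p + 1 = 2 ^ j := by omega
    have h3 : sawCost K (Saw.advance ⟨o, j, p, x⟩).outer (Saw.advance ⟨o, j, p, x⟩).inner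
        (Saw.advance ⟨o, j, p, x⟩).pos (afterSlot p M c) c
        = nextWindowCost K o j (afterSlot p M c).card := by
      unfold Saw.advance nextWindowCost
      by_cases hj : 0 < j <;> simp [h1, hj, sawCost]
    unfold Saw.advance at h3
    rw [h3]
    simp only [slotCost, hM', if_false, survivors_last j p M c h2]
    omega

lemma passReserve_succ {K o : ℕ} (h : o < K) :
    passReserve K o = o + 113 + passReserve K (o + 1) := by
  simp only [passReserve]
  rw [Finset.sum_eq_sum_Ico_succ_bot h]

lemma passReserve_le (K o : ℕ) : passReserve K o ≤ K * (K + 113) := by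
  calc passReserve K o ≤ ∑ _i ∈ Finset.Ico o K, (K + 113) :=
        Finset.sum_le_sum fun i hi => by rw [Finset.mem_Ico] at hi; omega
    _ ≤ K * (K + 113) := by
        rw [Finset.sum_const, Nat.card_Ico, smul_eq_mul]
        exact Nat.mul_le_mul_right _ (Nat.sub_le _ _)

/-- Half of `28 * 2 ^ (o + 1)` pays `7` for each of the fewer than `2 ^ (o + 2)` slots of the next
pass. The packets (`o + 2` windows) and the failure term (`112 = 28 * 4`) per station make up the
entry `(o + 1) + 113` of the reserve. -/
lemma windowCost_nextPass_le {k K : ℕ} (hK : ∀ o, K ≤ o → k * (o + 113) ≤ 14 * 2 ^ o)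
    (o R r : ℕ) (hR : R ≤ k) (hr : r ≤ R) :
    windowCost K (o + 1) (o + 1) r ≤ 28 * 2 ^ (o + 1) + R * passReserve K (o + 1) := by
  unfold windowCost
  split_ifs with h0
  · omega
  have h1 : r * 2 ^ (o + 1 + 2 - (o + 1)) = 4 * r := by
    rw [show o + 1 + 2 - (o + 1) = 2 by omega]; ring
  have h2 : 28 * min (2 ^ (o + 1 + 1)) (r * 2 ^ (o + 1 + 2 - (o + 1))) ≤ 112 * R := by
    rw [h1]
    have := min_le_right (2 ^ (o + 1 + 1)) (4 * r)
    omega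
  have h3 : r * (o + 1 + 1) ≤ R * (o + 1 + 1) := Nat.mul_le_mul_right _ hr
  have h4 : r * passReserve K (o + 1 + 1) ≤ R * passReserve K (o + 1 + 1) :=
    Nat.mul_le_mul_right _ hr
  have h5 : 2 ^ (o + 1 + 1) = 2 * 2 ^ (o + 1) := by ring
  by_cases h : o + 1 < K
  · rw [passReserve_succ h]
    have h6 : R * (o + 1 + 113 + passReserve K (o + 1 + 1))
        = R * (o + 1 + 1) + 112 * R + R * passReserve K (o + 1 + 1) := by ring
    omega
  -- Beyond pass `K` the reserve is empty, and the other half of `28 * 2 ^ (o + 1)` absorbs these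
  -- costs by `hK`.
  · have h6 : passReserve K (o + 1 + 1) = 0 := by
      unfold passReserve; rw [Finset.Ico_eq_empty (by omega), Finset.sum_empty]
    have h7 := hK (o + 1) (by omega)
    have h8 : R * (o + 1 + 113) ≤ k * (o + 1 + 113) := Nat.mul_le_mul_right _ hR
    have h9 : R * (o + 1 + 113) = R * (o + 1 + 1) + 112 * R := by ring
    rw [h6] at h4 ⊢
    omega

lemma two_pow_sub_mul_two_pow {o j : ℕ} (hj : j ≤ o) : 2 ^ (o + 2 - j) * 2 ^ j = 2 * 2 ^ (o + 1) := by
  rw [← pow_add, ← pow_succ']; congr 1; omega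

lemma slotCost_zero_le {k : ℕ} (K o j : ℕ) (M : Finset (Fin k)) (c : Fin k → ℕ) :
    slotCost K o j 0 M c ≤ 7 * 2 ^ j + M.card
      + nextWindowCost K o j (survivors j 0 M c).card := by
  unfold slotCost
  have := Finset.card_filter_le M fun v => 0 ≤ c v
  split_ifs <;> omega

/-- The windows that are small compared to the number of participants cost at most what they are
allowed to cost, whatever the random choices are. -/
lemma slotCost_le_windowCost {k K : ℕ} (hK : ∀ o, K ≤ o → k * (o + 113) ≤ 14 * 2 ^ o)
    {o j : ℕ} (hj : j ≤ o) (M : Finset (Fin k)) (c : Fin k → ℕ) (hM : M.Nonempty)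
    (h : j = 0 ∨ 2 ^ j ≤ 2 * M.card) :
    slotCost K o j 0 M c ≤ windowCost K o j M.card := by
  have hM0 : M.card ≠ 0 := hM.card_pos.ne'
  have hMk : M.card ≤ k := by simpa using Finset.card_le_univ M
  have hr : (survivors j 0 M c).card ≤ M.card := Finset.card_le_card (survivors_subset j 0 M c)
  refine (slotCost_zero_le K o j M c).trans ?_
  generalize (survivors j 0 M c).card = r at hr ⊢
  generalize M.card = R at *
  have hpow := two_pow_sub_mul_two_pow hj
  have h2j : 2 ^ j ≤ 2 * R := by
    rcases h with h | h
    · subst h; simp; omega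
    · exact h
  -- The minimum has reached its cap, the full price of another pass, so no success in this window
  -- has to be counted on.
  have hmin : min (2 ^ (o + 1)) (R * 2 ^ (o + 2 - j)) = 2 ^ (o + 1) := by
    refine min_eq_left (le_of_mul_le_mul_left (?_ : 2 * _ ≤ 2 * _) two_pos)
    calc 2 * 2 ^ (o + 1) = 2 ^ (o + 2 - j) * 2 ^ j := hpow.symm
      _ ≤ 2 ^ (o + 2 - j) * (2 * R) := Nat.mul_le_mul_left _ h2j
      _ = 2 * (R * 2 ^ (o + 2 - j)) := by ring
  rcases Nat.eq_zero_or_pos j with rfl | hj0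
  · have := windowCost_nextPass_le hK o R r hMk hr
    simp only [nextWindowCost, lt_irrefl, if_false]
    have h1 : windowCost K o 0 R = 7 * (2 ^ (0 + 1) - 1) + R * (0 + 1) + 28 * 2 ^ (o + 1)
        + R * passReserve K (o + 1) := by
      rw [windowCost, if_neg hM0, hmin]
    rw [h1]
    simp only [pow_zero]
    omega
  · simp only [nextWindowCost, hj0, if_true]
    have h5 : (2 : ℕ) ^ (j + 1) = 2 * 2 ^ j := by ring
    have h6 : 0 < 2 ^ j := Nat.two_pow_pos j
    have h7 : R * (j + 1) = R * j + R := by ring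
    have h8 : windowCost K o (j - 1) r ≤ 7 * (2 ^ j - 1) + R * j + 28 * 2 ^ (o + 1)
        + R * passReserve K (o + 1) := by
      unfold windowCost
      split_ifs
      · exact Nat.zero_le _
      · rw [Nat.sub_add_cancel hj0]
        gcongr
        exact min_le_left _ _
    have h9 : windowCost K o j R = 7 * (2 ^ (j + 1) - 1) + R * (j + 1) + 28 * 2 ^ (o + 1)
        + R * passReserve K (o + 1) := by
      rw [windowCost, if_neg hM0, hmin]
    omega

/-- In a large window the cost is linear in the number of survivors. -/
lemma slotCost_le_add_survivors {k : ℕ} (K : ℕ) {o j : ℕ} (hj : j ≤ o) (hj0 : 0 < j)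
    (M : Finset (Fin k)) (hM : M.Nonempty) (h : 2 * M.card < 2 ^ j) :
    ∃ A, (∀ c : Fin k → ℕ, slotCost K o j 0 M c
        ≤ A + 56 * 2 ^ (o + 2 - j) * (survivors j 0 M c).card) ∧
      A + 28 * (M.card * 2 ^ (o + 2 - j)) = windowCost K o j M.card := by
  have hM0 : M.card ≠ 0 := hM.card_pos.ne'
  have hpow := two_pow_sub_mul_two_pow hj
  have hmin : min (2 ^ (o + 1)) (M.card * 2 ^ (o + 2 - j)) = M.card * 2 ^ (o + 2 - j) := by
    refine min_eq_right (le_of_mul_le_mul_left (?_ : 2 * _ ≤ 2 * _) two_pos)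
    calc 2 * (M.card * 2 ^ (o + 2 - j)) = 2 ^ (o + 2 - j) * (2 * M.card) := by ring
      _ ≤ 2 ^ (o + 2 - j) * 2 ^ j := Nat.mul_le_mul_left _ h.le
      _ = 2 * 2 ^ (o + 1) := hpow
  -- `A` is `windowCost` without its failure term. Halving the window doubles the factor of that
  -- term, hence `56` per survivor against `28` per station now.
  refine ⟨7 * (2 ^ (j + 1) - 1) + M.card * (j + 1) + M.card * passReserve K (o + 1),
    fun c => ?_, ?_⟩
  · have hr : (survivors j 0 M c).card ≤ M.card := Finset.card_le_card (survivors_subset j 0 M c)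
    refine (slotCost_zero_le K o j M c).trans ?_
    generalize (survivors j 0 M c).card = r at hr ⊢
    generalize M.card = R at *
    simp only [nextWindowCost, hj0, if_true]
    have h5 : (2 : ℕ) ^ (j + 1) = 2 * 2 ^ j := by ring
    have h6 : 0 < 2 ^ j := Nat.two_pow_pos j
    have h7 : R * (j + 1) = R * j + R := by ring
    have h9 : o + 2 - (j - 1) = o + 2 - j + 1 := by omega
    have h8 : windowCost K o (j - 1) r ≤ 7 * (2 ^ j - 1) + R * j + 28 * (r * 2 ^ (o + 2 - j + 1))
        + R * passReserve K (o + 1) := by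
      unfold windowCost
      split_ifs
      · exact Nat.zero_le _
      · rw [Nat.sub_add_cancel hj0, h9]
        gcongr
        exact min_le_right _ _
    have h10 : 28 * (r * 2 ^ (o + 2 - j + 1)) = 56 * 2 ^ (o + 2 - j) * r := by ring
    omega
  · simp only [windowCost, hM0, if_false, hmin]
    ring

/-! ### Probability estimates for a single round. -/

/-- The law of the random numbers of one round. -/
noncomputable def roundLaw (k : ℕ) : Measure (Fin k → unitInterval) :=
  Measure.pi fun _ => volume

instance (k : ℕ) : IsProbabilityMeasure (roundLaw k) := by
  unfold roundLaw; infer_instance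

lemma volume_coe_lt_le (p : ℝ) :
    (volume : Measure unitInterval) {u | (u : ℝ) < p} ≤ ENNReal.ofReal p := by
  rw [unitInterval.volume_apply]
  calc volume (Subtype.val '' {u : unitInterval | (u : ℝ) < p}) ≤ volume (Set.Ico 0 p) := by
        refine measure_mono ?_
        rintro _ ⟨u, hu, rfl⟩
        exact ⟨u.2.1, hu⟩
    _ = ENNReal.ofReal p := by rw [Real.volume_Ico, sub_zero]

/-- The slot of a window of size `2 ^ j` that is determined by a random number. -/
noncomputable def slotOf (j : ℕ) (u : unitInterval) : ℕ := ⌊(u : ℝ) * 2 ^ j⌋₊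

lemma measurable_slotOf (j : ℕ) : Measurable (slotOf j) :=
  Nat.measurable_floor.comp (measurable_subtype_coe.mul_const _)

lemma measurableSet_slotOf (j m : ℕ) : MeasurableSet {u | slotOf j u = m} :=
  measurable_slotOf j (measurableSet_singleton m)

lemma volume_slotOf_le (j m : ℕ) :
    (volume : Measure unitInterval) {u | slotOf j u = m} ≤ (2 ^ j)⁻¹ := by
  rw [unitInterval.volume_apply]
  have h2 : (0 : ℝ) < 2 ^ j := by positivity
  calc volume (Subtype.val '' {u : unitInterval | slotOf j u = m})
      ≤ volume (Set.Ico ((m : ℝ) / 2 ^ j) ((m + 1) / 2 ^ j)) := by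
        refine measure_mono ?_
        rintro _ ⟨u, hu, rfl⟩
        have h0 : 0 ≤ (u : ℝ) * 2 ^ j := mul_nonneg u.2.1 h2.le
        have := (Nat.floor_eq_iff h0).1 hu
        exact ⟨(div_le_iff₀ h2).2 this.1, (lt_div_iff₀ h2).2 this.2⟩
    _ = (2 ^ j)⁻¹ := by
        rw [Real.volume_Ico, ← sub_div, add_sub_cancel_left, one_div,
          ENNReal.ofReal_inv_of_pos h2, ENNReal.ofReal_pow (by norm_num), ENNReal.ofReal_ofNat]

/-- Only `u = 1` gives a slot outside the window. -/
lemma volume_slotOf_ge (j : ℕ) :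
    (volume : Measure unitInterval) {u | ¬ slotOf j u < 2 ^ j} = 0 := by
  have h2 : (0 : ℝ) < 2 ^ j := by positivity
  refine measure_mono_null (t := {1}) (fun u hu => ?_) (measure_singleton _)
  have h0 : 0 ≤ (u : ℝ) * 2 ^ j := mul_nonneg u.2.1 h2.le
  have h1 : ((2 ^ j : ℕ) : ℝ) ≤ u * 2 ^ j := (Nat.le_floor_iff h0).1 (not_lt.1 hu)
  push_cast at h1
  have h3 : (1 : ℝ) ≤ u := by
    by_contra h
    nlinarith
  exact Subtype.ext (le_antisymm u.2.2 h3)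

lemma roundLaw_eval {k : ℕ} (v : Fin k) {A : Set unitInterval} (hA : MeasurableSet A) :
    roundLaw k {u | u v ∈ A} = volume A :=
  (measurePreserving_eval (fun _ : Fin k => (volume : Measure unitInterval)) v).measure_preimage
    hA.nullMeasurableSet

lemma roundLaw_eval_pair {k : ℕ} {v w : Fin k} (hvw : v ≠ w) {A B : Set unitInterval} :
    roundLaw k {u | u v ∈ A ∧ u w ∈ B} = volume A * volume B := by
  classical
  have h : {u : Fin k → unitInterval | u v ∈ A ∧ u w ∈ B}
      = Set.univ.pi fun x => if x = v then A else if x = w then B else Set.univ := by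
    ext u
    simp only [Set.mem_ofPred_eq, Set.mem_pi, Set.mem_univ, true_implies]
    constructor
    · rintro ⟨h1, h2⟩ x
      split_ifs with h3 h4
      · exact h3 ▸ h1
      · exact h4 ▸ h2
      · trivial
    · intro h1
      have h2 := h1 v
      have h3 := h1 w
      simp only [if_true, hvw.symm, if_false] at h2 h3
      exact ⟨h2, h3⟩
  rw [h, roundLaw, Measure.pi_pi, ← Finset.prod_subset (Finset.subset_univ {v, w}),
    Finset.prod_pair hvw]
  · simp [hvw.symm]
  · intro x _ hx
    simp only [Finset.mem_insert, Finset.mem_singleton, not_or] at hx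
    simp [hx.1, hx.2]

/-- For each value of the slot of `v`, the independent station `w` hits it with probability at most
`2⁻ʲ`; sum over the values. -/
lemma roundLaw_slotOf_eq_le {k : ℕ} (j : ℕ) {v w : Fin k} (hvw : v ≠ w) :
    roundLaw k {u | slotOf j (u w) = slotOf j (u v)} ≤ (2 ^ j)⁻¹ := by
  have h : {u : Fin k → unitInterval | slotOf j (u w) = slotOf j (u v)}
      = ⋃ m : ℕ, {u | u v ∈ {x | slotOf j x = m} ∧ u w ∈ {x | slotOf j x = m}} := by
    ext u
    simp [eq_comm]
  have hd : Pairwise (Function.onFun Disjoint fun m : ℕ => {x | slotOf j x = m}) := by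
    intro m n hmn
    refine Set.disjoint_left.2 fun x hx hx' => hmn ?_
    rw [Set.mem_ofPred_eq] at hx hx'
    exact hx.symm.trans hx'
  calc roundLaw k {u | slotOf j (u w) = slotOf j (u v)}
      ≤ ∑' m : ℕ, roundLaw k {u | u v ∈ {x | slotOf j x = m} ∧ u w ∈ {x | slotOf j x = m}} := by
        rw [h]; exact measure_iUnion_le _
    _ ≤ ∑' m : ℕ, (volume : Measure unitInterval) {x | slotOf j x = m} * (2 ^ j)⁻¹ := by
        refine ENNReal.tsum_le_tsum fun m => ?_
        rw [roundLaw_eval_pair hvw]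
        gcongr
        exact volume_slotOf_le j m
    _ = (∑' m : ℕ, (volume : Measure unitInterval) {x | slotOf j x = m}) * (2 ^ j)⁻¹ :=
        ENNReal.tsum_mul_right
    _ ≤ 1 * (2 ^ j)⁻¹ := by
        gcongr
        rw [← measure_iUnion hd fun m => measurableSet_slotOf j m]
        exact prob_le_one
    _ = (2 ^ j)⁻¹ := one_mul _

/-- The expected number of stations that fail in a window. -/
lemma lintegral_card_survivors_le {k : ℕ} (j : ℕ) (M : Finset (Fin k)) :
    ∫⁻ u, ((survivors j 0 M fun v => slotOf j (u v)).card : ℝ≥0∞) ∂(roundLaw k)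
      ≤ M.card * (M.card * (2 ^ j)⁻¹) := by
  classical
  have hm : ∀ v w : Fin k, MeasurableSet {u : Fin k → unitInterval | slotOf j (u w) = slotOf j (u v)} :=
    fun v w => measurableSet_eq_fun ((measurable_slotOf j).comp (measurable_pi_apply w))
      ((measurable_slotOf j).comp (measurable_pi_apply v))
  have hm' : ∀ v : Fin k, MeasurableSet {u : Fin k → unitInterval | ¬ slotOf j (u v) < 2 ^ j} :=
    fun v => (((measurable_slotOf j).comp (measurable_pi_apply v)) measurableSet_Iio).compl
  -- Union bound: a survivor shares its slot with another station or has drawn a slot outside the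
  -- window.
  have hpt : ∀ u : Fin k → unitInterval,
      ((survivors j 0 M fun v => slotOf j (u v)).card : ℝ≥0∞)
        ≤ ∑ v ∈ M, ({u : Fin k → unitInterval | ¬ slotOf j (u v) < 2 ^ j}.indicator 1 u
          + ∑ w ∈ M.erase v,
            {u : Fin k → unitInterval | slotOf j (u w) = slotOf j (u v)}.indicator 1 u) := by
    intro u
    rw [survivors, Finset.card_filter, Nat.cast_sum]
    refine Finset.sum_le_sum fun v hv => ?_
    split_ifs with h
    · rw [Nat.cast_zero]
      exact zero_le
    · by_cases h1 : slotOf j (u v) < 2 ^ j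
      · obtain ⟨w, hw, hwv, hne⟩ : ∃ w ∈ M, slotOf j (u w) = slotOf j (u v) ∧ w ≠ v := by
          by_contra! hc
          exact h ⟨Nat.zero_le _, h1, hc⟩
        refine le_add_left ?_
        refine le_trans ?_ (Finset.single_le_sum (fun _ _ => zero_le)
          (Finset.mem_erase.2 ⟨hne, hw⟩))
        rw [Set.indicator_of_mem (by exact hwv)]
        simp
      · refine le_add_right ?_
        rw [Set.indicator_of_mem (by exact h1)]
        simp
  calc _ ≤ ∫⁻ u, ∑ v ∈ M, ({u : Fin k → unitInterval | ¬ slotOf j (u v) < 2 ^ j}.indicator 1 u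
          + ∑ w ∈ M.erase v,
            {u : Fin k → unitInterval | slotOf j (u w) = slotOf j (u v)}.indicator 1 u)
          ∂(roundLaw k) := lintegral_mono hpt
    _ = ∑ v ∈ M, (roundLaw k {u | ¬ slotOf j (u v) < 2 ^ j}
          + ∑ w ∈ M.erase v, roundLaw k {u | slotOf j (u w) = slotOf j (u v)}) := by
        rw [lintegral_finsetSum]
        · refine Finset.sum_congr rfl fun v _ => ?_
          rw [lintegral_add_left (measurable_one.indicator (hm' v)), lintegral_indicator_one (hm' v),
            lintegral_finsetSum _ fun w _ => measurable_one.indicator (hm v w)]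
          simp_rw [lintegral_indicator_one (hm v _)]
        · exact fun v _ => (measurable_one.indicator (hm' v)).add
            (Finset.measurable_sum _ fun w _ => measurable_one.indicator (hm v w))
    _ ≤ ∑ v ∈ M, (0 + ∑ w ∈ M.erase v, (2 ^ j)⁻¹) := by
        gcongr with v _ w hw
        · have := roundLaw_eval v (A := {x | ¬ slotOf j x < 2 ^ j})
            ((measurable_slotOf j measurableSet_Iio).compl)
          exact (this.trans (volume_slotOf_ge j)).le
        · exact roundLaw_slotOf_eq_le j (Finset.ne_of_mem_erase hw).symm
    _ ≤ M.card * (M.card * (2 ^ j)⁻¹) := by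
        simp only [zero_add, Finset.sum_const, nsmul_eq_mul]
        rw [← nsmul_eq_mul, ← Finset.sum_const]
        refine Finset.sum_le_sum fun v _ => ?_
        gcongr
        exact Finset.erase_subset v M

/-- The window cost is a bound on the expected cost once the random choices have been made. -/
lemma lintegral_slotCost_le {k K : ℕ} (hK : ∀ o, K ≤ o → k * (o + 113) ≤ 14 * 2 ^ o)
    {o j : ℕ} (hj : j ≤ o) (M : Finset (Fin k)) :
    ∫⁻ u, (slotCost K o j 0 M (fun v => slotOf j (u v)) : ℝ≥0∞) ∂(roundLaw k)
      ≤ windowCost K o j M.card := by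
  rcases M.eq_empty_or_nonempty with rfl | hM
  · simp
  by_cases h : j = 0 ∨ 2 ^ j ≤ 2 * M.card
  · calc _ ≤ ∫⁻ _, (windowCost K o j M.card : ℝ≥0∞) ∂(roundLaw k) :=
          lintegral_mono fun u =>
            Nat.cast_le.2 (slotCost_le_windowCost hK hj M (fun v => slotOf j (u v)) hM h)
      _ = _ := by simp
  · push Not at h
    obtain ⟨A, hA, hA'⟩ := slotCost_le_add_survivors K hj (Nat.pos_of_ne_zero h.1) M hM h.2
    set D : ℕ := 2 ^ (o + 2 - j)
    calc _ ≤ ∫⁻ u, ((A : ℝ≥0∞) + (56 * D : ℕ)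
            * ((survivors j 0 M fun v => slotOf j (u v)).card : ℝ≥0∞)) ∂(roundLaw k) :=
          lintegral_mono fun u =>
            (Nat.cast_le.2 (hA fun v => slotOf j (u v))).trans_eq (by push_cast; rfl)
      _ = A + (56 * D : ℕ)
            * ∫⁻ u, ((survivors j 0 M fun v => slotOf j (u v)).card : ℝ≥0∞) ∂(roundLaw k) := by
          rw [lintegral_add_left measurable_const, lintegral_const_mul' _ _ (ENNReal.natCast_ne_top _)]
          simp
      _ ≤ A + (56 * D : ℕ) * (M.card * (M.card * (2 ^ j)⁻¹)) := by
          gcongr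
          exact lintegral_card_survivors_le j M
      _ ≤ A + (28 * (M.card * D) : ℕ) := by
          -- In a window with `2 ^ j > 2R` the expected fraction of survivors is at most `1/2`,
          -- which offsets the doubled factor.
          have h3 : (2 * (M.card * (2 ^ j)⁻¹) : ℝ≥0∞) ≤ 1 := by
            rw [← mul_assoc, ← div_eq_mul_inv]
            refine ENNReal.div_le_of_le_mul ?_
            rw [one_mul]
            exact_mod_cast h.2.le
          have h4 : (((56 * D : ℕ) : ℝ≥0∞)) * (M.card * (M.card * (2 ^ j)⁻¹))
              = (28 * (M.card * D) : ℕ) * (2 * (M.card * (2 ^ j)⁻¹)) := by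
            push_cast; ring
          rw [h4]
          gcongr
          exact mul_le_of_le_one_right zero_le h3
      _ = windowCost K o j M.card := by exact_mod_cast hA'

/-- If every station `v ∈ S` transmits independently with probability `volume (A v)`, then the
probability of exactly one transmission is at least the expected number of transmissions minus
its square. -/
lemma sum_volume_le_prob_card_eq_one {k : ℕ} (S : Finset (Fin k)) (A : Fin k → Set unitInterval)
    (hA : ∀ v, MeasurableSet (A v)) (T : (Fin k → unitInterval) → Finset (Fin k))
    (hT : ∀ u v, v ∈ T u ↔ v ∈ S ∧ u v ∈ A v) :
    ∑ v ∈ S, (volume : Measure unitInterval) (A v)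
      ≤ roundLaw k {u | (T u).card = 1}
        + (∑ v ∈ S, volume (A v)) * ∑ v ∈ S, (volume : Measure unitInterval) (A v) := by
  classical
  have hm : ∀ v, MeasurableSet {u : Fin k → unitInterval | u v ∈ A v} :=
    fun v => (hA v).preimage (measurable_pi_apply v)
  have hm2 : ∀ v w, MeasurableSet {u : Fin k → unitInterval | u v ∈ A v ∧ u w ∈ A w} :=
    fun v w => (hm v).inter (hm w)
  -- The number of transmitters is at most the indicator of exactly one plus the number of ordered
  -- pairs of distinct transmitters.
  have hpt : ∀ u : Fin k → unitInterval,
      ∑ v ∈ S, {u : Fin k → unitInterval | u v ∈ A v}.indicator (1 : (Fin k → unitInterval) → ℝ≥0∞) u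
        ≤ {u | (T u).card = 1}.indicator 1 u
          + ∑ v ∈ S, ∑ w ∈ S.erase v,
            {u : Fin k → unitInterval | u v ∈ A v ∧ u w ∈ A w}.indicator 1 u := by
    intro u
    by_cases h1 : (T u).card = 1
    · refine le_add_right ?_
      rw [Set.indicator_of_mem (by exact h1), Pi.one_apply]
      obtain ⟨x, hx⟩ := Finset.card_eq_one.1 h1
      calc _ ≤ ∑ v ∈ S, if v = x then (1 : ℝ≥0∞) else 0 := by
            refine Finset.sum_le_sum fun v hv => ?_
            by_cases h2 : u v ∈ A v
            · have : v ∈ T u := (hT u v).2 ⟨hv, h2⟩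
              rw [hx, Finset.mem_singleton] at this
              rw [if_pos this, Set.indicator_of_mem (by exact h2), Pi.one_apply]
            · rw [Set.indicator_of_notMem (by exact h2)]
              exact zero_le
        _ ≤ 1 := by
            rw [Finset.sum_ite_eq']
            split_ifs <;> simp
    · refine le_add_left (Finset.sum_le_sum fun v hv => ?_)
      by_cases h2 : u v ∈ A v
      · have hv' : v ∈ T u := (hT u v).2 ⟨hv, h2⟩
        have : ∃ w ∈ T u, w ≠ v := by
          by_contra! h
          exact h1 (Finset.card_eq_one.2 ⟨v, Finset.eq_singleton_iff_unique_mem.2 ⟨hv', h⟩⟩)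
        obtain ⟨w, hw, hwv⟩ := this
        have hw' := (hT u w).1 hw
        refine le_trans ?_ (Finset.single_le_sum (fun _ _ => zero_le)
          (Finset.mem_erase.2 ⟨hwv, hw'.1⟩))
        rw [Set.indicator_of_mem (by exact h2), Set.indicator_of_mem (by exact ⟨h2, hw'.2⟩)]
      · rw [Set.indicator_of_notMem (by exact h2)]
        exact zero_le
  have hTm : MeasurableSet {u | (T u).card = 1} := by
    have : {u | (T u).card = 1} = ⋃ x : Fin k, ⋂ v, {u | (v ∈ S ∧ u v ∈ A v) ↔ v = x} := by
      ext u
      simp only [Set.mem_ofPred_eq, Finset.card_eq_one, Set.mem_iUnion, Set.mem_iInter,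
        Finset.ext_iff, Finset.mem_singleton, hT]
    rw [this]
    refine MeasurableSet.iUnion fun x => MeasurableSet.iInter fun v => ?_
    exact ((MeasurableSet.const _).inter (hm v)).iff (MeasurableSet.const _)
  calc ∑ v ∈ S, (volume : Measure unitInterval) (A v)
      = ∫⁻ u, ∑ v ∈ S, {u : Fin k → unitInterval | u v ∈ A v}.indicator 1 u ∂(roundLaw k) := by
        rw [lintegral_finsetSum _ fun v _ => measurable_one.indicator (hm v)]
        refine Finset.sum_congr rfl fun v _ => ?_
        rw [lintegral_indicator_one (hm v), roundLaw_eval v (hA v)]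
    _ ≤ _ := lintegral_mono hpt
    _ = roundLaw k {u | (T u).card = 1}
        + ∑ v ∈ S, ∑ w ∈ S.erase v, volume (A v) * (volume : Measure unitInterval) (A w) := by
        rw [lintegral_add_left (measurable_one.indicator hTm), lintegral_indicator_one hTm,
          lintegral_finsetSum _ fun v _ => Finset.measurable_sum _ fun w _ =>
            measurable_one.indicator (hm2 v w)]
        congr 1
        refine Finset.sum_congr rfl fun v _ => ?_
        rw [lintegral_finsetSum _ fun w _ => measurable_one.indicator (hm2 v w)]
        refine Finset.sum_congr rfl fun w hw => ?_
        rw [lintegral_indicator_one (hm2 v w), roundLaw_eval_pair (Finset.ne_of_mem_erase hw).symm]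
    _ ≤ _ := by
        gcongr
        rw [Finset.sum_mul_sum]
        gcongr with v
        exact Finset.erase_subset v S

/-! ### White rounds and the cost of a dissemination mode. -/

lemma exists_isWhite_add (tc : ℕ) : ∃ n ≤ tc + 4, IsWhite (tc + n) := by
  rcases Nat.lt_or_ge tc 2 with h | h
  · exact ⟨4 - tc, by omega, 2, le_rfl, by omega⟩
  · have h1 := Nat.pow_log_le_self 2 (show tc ≠ 0 by omega)
    have h2 := Nat.lt_pow_succ_log_self (b := 2) (by norm_num) tc
    have h3 : 1 ≤ Nat.log 2 tc := (Nat.le_log_iff_pow_le (by norm_num) (by omega)).2 (by omega)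
    have h4 : 2 ^ (Nat.log 2 tc + 1) = 2 * 2 ^ Nat.log 2 tc := by ring
    rw [Nat.succ_eq_add_one] at h2
    exact ⟨2 ^ (Nat.log 2 tc + 1) - tc, by omega, Nat.log 2 tc + 1, by omega, by omega⟩

/-- The number of rounds from round `tc` to the next round in which all participants of a
dissemination mode transmit. -/
noncomputable def untilWhite (tc : ℕ) : ℕ := sInf {n | IsWhite (tc + n)}

lemma isWhite_add_untilWhite (tc : ℕ) : IsWhite (tc + untilWhite tc) :=
  Nat.sInf_mem (s := {n | IsWhite (tc + n)}) ((exists_isWhite_add tc).imp fun _ h => h.2)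

lemma untilWhite_le_of_isWhite {tc n : ℕ} (h : IsWhite (tc + n)) : untilWhite tc ≤ n :=
  Nat.sInf_le h

lemma untilWhite_le (tc : ℕ) : untilWhite tc ≤ tc + 4 := by
  obtain ⟨n, hn, h⟩ := exists_isWhite_add tc
  exact (untilWhite_le_of_isWhite h).trans hn

lemma untilWhite_eq_zero {tc : ℕ} (h : IsWhite tc) : untilWhite tc = 0 :=
  Nat.le_zero.1 (untilWhite_le_of_isWhite h)

lemma untilWhite_succ_lt {tc : ℕ} (h : ¬ IsWhite tc) : untilWhite (tc + 1) + 1 ≤ untilWhite tc := by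
  have h1 := isWhite_add_untilWhite tc
  rcases Nat.eq_zero_or_pos (untilWhite tc) with h0 | h0
  · rw [h0] at h1; exact absurd h1 h
  · have : untilWhite (tc + 1) ≤ untilWhite tc - 1 := untilWhite_le_of_isWhite (by
      rwa [show tc + 1 + (untilWhite tc - 1) = tc + untilWhite tc by omega])
    omega

lemma untilWhite_le_succ (tc : ℕ) : untilWhite tc ≤ untilWhite (tc + 1) + 1 :=
  untilWhite_le_of_isWhite (by
    rw [show tc + (untilWhite (tc + 1) + 1) = tc + 1 + untilWhite (tc + 1) by omega]
    exact isWhite_add_untilWhite (tc + 1))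

/-- The gap between consecutive powers of two equals the smaller one. Hence `leadCost` drops by
roughly `tc` in a white round. -/
lemma le_untilWhite_succ {tc : ℕ} (h : IsWhite tc) : tc ≤ untilWhite (tc + 1) + 1 := by
  obtain ⟨x, _, rfl⟩ := h
  obtain ⟨y, _, h2⟩ := isWhite_add_untilWhite (2 ^ x + 1)
  have h3 : x < y := (Nat.pow_lt_pow_iff_right (a := 2) (by norm_num)).1 (by omega)
  have h4 : 2 ^ (x + 1) ≤ 2 ^ y := Nat.pow_le_pow_right (by norm_num) h3
  have h5 : 2 ^ (x + 1) = 2 * 2 ^ x := by ring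
  omega

/-- The cost that is set aside for the leader before round `tc` if `R` other stations are active;
it also covers the transmissions of these stations in late white rounds. -/
noncomputable def leadCost (tc R : ℕ) : ℕ :=
  if R = 0 then untilWhite tc + 1 else 2 * tc + 9 - untilWhite tc

/-- The number of powers `2 ^ x ≥ tc` with `x < X`. -/
def whitesLeft (X tc : ℕ) : ℕ := ((Finset.range X).filter fun x => tc ≤ 2 ^ x).card

lemma whitesLeft_succ_le (X tc : ℕ) : whitesLeft X (tc + 1) ≤ whitesLeft X tc :=
  Finset.card_le_card (Finset.monotone_filter_right _ fun x _ h => by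
    omega)

lemma whitesLeft_le (X tc : ℕ) : whitesLeft X tc ≤ X :=
  (Finset.card_filter_le _ _).trans (Finset.card_range X).le

lemma whitesLeft_lt {X x : ℕ} (h : x < X) :
    whitesLeft X (2 ^ x + 1) + 1 ≤ whitesLeft X (2 ^ x) := by
  refine Finset.card_lt_card (Finset.ssubset_iff_of_subset ?_ |>.2 ⟨x, by simp [h], by simp⟩)
  exact Finset.monotone_filter_right _ fun y _ h => by
    omega

open scoped Classical in
/-- Bound on the expected remaining number of transmissions in a dissemination mode before its
round `tc`, where `M` are the active non-leaders, which are about to execute slot `p` of the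
window of size `2 ^ j` in pass `o` with transmission slots `c`. -/
noncomputable def phaseCost {k : ℕ} (X K tc o j p : ℕ) (M : Finset (Fin k)) (c : Fin k → ℕ) : ℕ :=
  leadCost tc M.card + M.card * whitesLeft X tc + (if Even tc ∧ M.Nonempty then 4 else 0)
    + sawCost K o j p M c

/-- The right side has `slotCost` where `phaseCost` has `sawCost`, because the slots of a window are
drawn in the very round that executes its slot `0`. -/
lemma phaseCost_odd {k : ℕ} (X K tc o j p x : ℕ) (M : Finset (Fin k)) (c : Fin k → ℕ)
    (hp : p < 2 ^ j) (ht : Odd tc) :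
    (M.filter fun v => c v = p).card +
      phaseCost X K (tc + 1) (Saw.advance ⟨o, j, p, x⟩).outer (Saw.advance ⟨o, j, p, x⟩).inner
        (Saw.advance ⟨o, j, p, x⟩).pos (afterSlot p M c) c
      ≤ leadCost tc M.card + M.card * whitesLeft X tc + slotCost K o j p M c := by
  have hw : ¬ IsWhite tc := by
    rintro ⟨x, hx, rfl⟩
    exact (Nat.not_even_iff_odd.2 ht) ((Nat.even_pow.2 ⟨even_two, by omega⟩))
  have h1 := untilWhite_succ_lt hw
  have h1' := untilWhite_le_succ tc
  have h2 := untilWhite_le tc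
  rcases M.eq_empty_or_nonempty with rfl | hM
  · have : afterSlot p ∅ c = ∅ := Finset.subset_empty.1 (afterSlot_subset p ∅ c)
    simp only [phaseCost, this, leadCost]
    simp
    omega
  · have h3 := card_slot_add_sawCost_le K o j p x M c hp hM
    have h4 : (afterSlot p M c).card * whitesLeft X (tc + 1) ≤ M.card * whitesLeft X tc :=
      Nat.mul_le_mul (Finset.card_le_card (afterSlot_subset p M c)) (whitesLeft_succ_le X tc)
    have h5 : leadCost (tc + 1) (afterSlot p M c).card ≤ leadCost tc M.card + 3 := by
      have := hM.card_pos.ne'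
      simp only [leadCost, this, if_false]
      split_ifs <;> omega
    unfold phaseCost
    split_ifs <;> omega

/-- The stored `4` pays the leader's message and the growth of `leadCost` by `3`. Without
non-leaders the countdown to the next white round pays. -/
lemma phaseCost_even {k : ℕ} (X K tc o j p : ℕ) (M : Finset (Fin k)) (c : Fin k → ℕ)
    (ht : Even tc) (hw : ¬ IsWhite tc) :
    1 + phaseCost X K (tc + 1) o j p M c ≤ phaseCost X K tc o j p M c := by
  have h1 := untilWhite_succ_lt hw
  have h1' := untilWhite_le_succ tc
  have h2 := untilWhite_le tc
  have h4 : M.card * whitesLeft X (tc + 1) ≤ M.card * whitesLeft X tc :=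
    Nat.mul_le_mul le_rfl (whitesLeft_succ_le X tc)
  have h5 : ¬ Even (tc + 1) := Nat.not_even_iff_odd.2 ht.add_one
  rcases M.eq_empty_or_nonempty with rfl | hM
  · simp [phaseCost, leadCost]
    omega
  · have := hM.card_pos.ne'
    simp only [phaseCost, h5, ht, hM, leadCost, this, if_false, false_and, true_and, if_true]
    omega

/-- `leadCost` falls by at least `tc - 3`, which with the stored `4` makes `tc + 1` available: one
unit for the leader, and `tc` for the non-leaders when `whitesLeft` no longer pays for them, as then
`M.card ≤ k ≤ 2 ^ X ≤ tc`. -/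
lemma phaseCost_white {k : ℕ} (X K tc o j p : ℕ) (M : Finset (Fin k)) (c : Fin k → ℕ)
    (hw : IsWhite tc) (hM : M.Nonempty) (hX : k ≤ 2 ^ X) :
    M.card + 1 + phaseCost X K (tc + 1) o j p M c ≤ phaseCost X K tc o j p M c := by
  have h0 := untilWhite_eq_zero hw
  have h1 := le_untilWhite_succ hw
  have h2 := untilWhite_le (tc + 1)
  have hMk : M.card ≤ k := by simpa using Finset.card_le_univ M
  have h3 : M.card + M.card * whitesLeft X (tc + 1) ≤ M.card * whitesLeft X tc + tc := by
    obtain ⟨x, hx, rfl⟩ := hw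
    rcases Nat.lt_or_ge x X with h | h
    · have := Nat.mul_le_mul_left M.card (whitesLeft_lt h)
      rw [mul_add, mul_one] at this
      have := Nat.two_pow_pos x
      omega
    · have h3 := Nat.mul_le_mul_left M.card (whitesLeft_succ_le X (2 ^ x))
      have h4 : 2 ^ X ≤ 2 ^ x := Nat.pow_le_pow_right (by norm_num) h
      omega
  have ht : Even tc := by
    obtain ⟨x, hx, rfl⟩ := hw
    exact Nat.even_pow.2 ⟨even_two, by omega⟩
  have h5 : ¬ Even (tc + 1) := Nat.not_even_iff_odd.2 ht.add_one
  have := hM.card_pos.ne'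
  simp only [phaseCost, h5, ht, hM, leadCost, this, if_false, false_and, true_and, if_true]
  omega

lemma one_le_phaseCost_empty {k : ℕ} (X K tc o j p : ℕ) (c : Fin k → ℕ) :
    1 ≤ phaseCost X K tc o j p ∅ c := by
  simp [phaseCost, leadCost]

lemma phaseCost_start_le {k : ℕ} (X K : ℕ) (M : Finset (Fin k)) (c : Fin k → ℕ) :
    phaseCost X K 1 0 0 0 M c ≤ (100 + X + K * (K + 113)) * (M.card + 1) := by
  have h1 : leadCost 1 M.card ≤ 11 := by
    have := untilWhite_le 1
    unfold leadCost
    split_ifs <;> omega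
  have h2 : M.card * whitesLeft X 1 ≤ M.card * X := Nat.mul_le_mul_left _ (whitesLeft_le X 1)
  -- Pass `0` has one slot, which costs `7`; the capped failure term is `28 * 2`.
  have h3 : sawCost K 0 0 0 M c ≤ 63 + M.card + M.card * (K * (K + 113)) := by
    have h4 : M.card * passReserve K 1 ≤ M.card * (K * (K + 113)) :=
      Nat.mul_le_mul_left _ (passReserve_le K 1)
    have h5 := min_le_left 2 (M.card * 4)
    simp only [sawCost, if_true, windowCost]
    norm_num
    split_ifs <;> omega
  have h6 : (100 + X + K * (K + 113)) * (M.card + 1)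
      = 100 * M.card + 100 + X + M.card * X + K * (K + 113) + M.card * (K * (K + 113)) := by ring
  unfold phaseCost
  rw [h6, if_neg (by simp)]
  omega

/-! ### What stations perceive, and one round as a map on states. -/

section Feedback

variable {k : ℕ} {sent : Fin k → Option Message}

lemma mem_transmitters {v : Fin k} : v ∈ transmitters sent ↔ (sent v).isSome := by
  simp [transmitters]

lemma feedback_of_card_ne_one (h : (transmitters sent).card ≠ 1) (v : Fin k) :
    feedback sent v = .nothing := by
  simp [feedback, channel, h]

lemma channel_of_transmitters_eq {w : Fin k} {m : Message} (h : transmitters sent = {w})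
    (hw : sent w = some m) : channel sent = some m := by
  have h1 : ((List.finRange k).findSome? sent).isSome := by
    rw [List.findSome?_isSome_iff]
    exact ⟨w, List.mem_finRange w, by simp [hw]⟩
  obtain ⟨m', hm'⟩ := Option.isSome_iff_exists.1 h1
  obtain ⟨v, _, hv⟩ := List.exists_of_findSome?_eq_some hm'
  have h2 : v ∈ transmitters sent := by rw [mem_transmitters, hv]; rfl
  rw [h, Finset.mem_singleton] at h2
  rw [channel, h, Finset.card_singleton, if_pos rfl, hm', ← hv, h2, hw]

lemma feedback_self {w : Fin k} {m : Message} (h : transmitters sent = {w})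
    (hw : sent w = some m) : feedback sent w = .ack := by
  simp [feedback, channel_of_transmitters_eq h hw, hw]

lemma feedback_other {v w : Fin k} {m : Message} (h : transmitters sent = {w})
    (hw : sent w = some m) (hv : v ≠ w) : feedback sent v = .received m := by
  have h1 : sent v = none := by
    by_contra h2
    have : v ∈ transmitters sent := mem_transmitters.2 (Option.isSome_iff_ne_none.2 h2)
    rw [h, Finset.mem_singleton] at this
    exact hv this
  simp [feedback, channel_of_transmitters_eq h hw, h1]

end Feedback

/-- The messages sent in a round that starts with the states `st`. -/
noncomputable def sentFrom {k : ℕ} (q : ℝ) (st : Fin k → Station) (u : Fin k → unitInterval) :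
    Fin k → Option Message :=
  fun v => (st v).send q (u v)

/-- The states after a round that starts with the states `st`, if the adversary activates `A`. -/
noncomputable def stepStates {k : ℕ} (q : ℝ) (A : Finset (Fin k)) (st : Fin k → Station)
    (u : Fin k → unitInterval) : Fin k → Station :=
  fun v => match st v with
    | .asleep => if v ∈ A then .wait 0 false else .asleep
    | s => s.next (u v) (feedback (sentFrom q st u) v)

lemma playRound_eq {k : ℕ} (q : ℝ) (adv : Adversary k) (u : Fin k → unitInterval)
    (h : List (Snapshot k)) :
    playRound q adv u h
      = ⟨sentFrom q (currentState h) u, stepStates q (adv h) (currentState h) u⟩ := rfl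

lemma stepStates_of_ne_asleep {k : ℕ} (q : ℝ) (A : Finset (Fin k)) (st : Fin k → Station)
    (u : Fin k → unitInterval) {v : Fin k} (h : st v ≠ .asleep) :
    stepStates q A st u v = (st v).next (u v) (feedback (sentFrom q st u) v) := by
  unfold stepStates
  cases hv : st v <;> simp_all

lemma stepStates_asleep {k : ℕ} (q : ℝ) (A : Finset (Fin k)) (st : Fin k → Station)
    (u : Fin k → unitInterval) {v : Fin k} (h : st v = .asleep) :
    stepStates q A st u v = .asleep ∨ stepStates q A st u v = .wait 0 false := by
  unfold stepStates
  rw [h]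
  by_cases hv : v ∈ A <;> simp [hv]

/-! ### Weights of single stations. -/

section Weights

/-- Bound on the transmission probability in iteration `i` of `DecreaseSlowly`. -/
noncomputable def electProb (q : ℝ) (i : ℕ) : ℝ≥0∞ := ENNReal.ofReal (q / (2 * q + i))

/-- The expected number of transmissions in the iterations `i, …, N - 1` of `DecreaseSlowly`. -/
noncomputable def electReserve (q : ℝ) (N i : ℕ) : ℝ≥0∞ := ∑ l ∈ Finset.Ico i N, electProb q l

/-- The transmission probability in iteration `i`, cut off at iteration `N`. -/
noncomputable def cutProb (q : ℝ) (N : ℕ) : Station → ℝ≥0∞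
  | .elect i => if i < N then electProb q i else 0
  | _ => 0

/-- The potential of a single station. -/
noncomputable def weight (q : ℝ) (N c : ℕ) : Station → ℝ≥0∞
  | .asleep => c + 2 + 2 * electReserve q N 0
  | .wait _ _ => c + 2 + 2 * electReserve q N 0
  | .elect i => c + 2 + 2 * electReserve q N i
  | _ => 0

lemma electReserve_eq (q : ℝ) (N i : ℕ) :
    electReserve q N i = (if i < N then electProb q i else 0) + electReserve q N (i + 1) := by
  unfold electReserve
  split_ifs with h
  · rw [Finset.sum_eq_sum_Ico_succ_bot h]
  · rw [Finset.Ico_eq_empty (by omega), Finset.Ico_eq_empty (by omega)]; simp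

lemma weight_elect (q : ℝ) (N c i : ℕ) :
    weight q N c (.elect i) = c + 2 + 2 * electReserve q N (i + 1)
      + 2 * cutProb q N (.elect i) := by
  simp only [weight, cutProb]
  rw [electReserve_eq q N i]
  ring

end Weights

/-! ### Invariants of the two kinds of configurations. -/

/-- States in which no dissemination mode is running. -/
def IsElection {k : ℕ} (st : Fin k → Station) : Prop :=
  ∀ v, (∀ tc, st v ≠ .lead tc) ∧ ∀ tc s, st v ≠ .member tc s

/-- There has been no round in which the leader is sure to be heard among the last `i` rounds
before round `tc` of a dissemination mode. -/
def QuietFor (i tc : ℕ) : Prop := ∀ r < tc, tc ≤ r + i → ¬ (Even r ∧ ¬ IsWhite r)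

/-- The states that are possible for stations other than the leader in a dissemination mode. -/
def IsFollower (tc o j p : ℕ) : Station → Prop
  | .asleep => True
  | .wait i heard => heard = false → QuietFor i tc
  | .elect _ => False
  | .lead _ => False
  | .member t s => t = tc ∧ s.outer = o ∧ s.inner = j ∧ s.pos = p
  | .off => True

/-- A dissemination mode with leader `l` is about to execute its round `tc`, in which its
non-leaders are before slot `p` of the window of size `2 ^ j` of pass `o`. -/
structure IsDissemination {k : ℕ} (st : Fin k → Station) (l : Fin k) (tc o j p : ℕ) : Prop where
  pos : 1 ≤ tc
  inner_le : j ≤ o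
  slot_lt : p < 2 ^ j
  leader : st l = .lead tc
  follower : ∀ v ≠ l, IsFollower tc o j p (st v)

open scoped Classical in
/-- The active non-leaders. -/
noncomputable def members {k : ℕ} (st : Fin k → Station) : Finset (Fin k) :=
  Finset.univ.filter fun v => ∃ tc s, st v = .member tc s

lemma mem_members {k : ℕ} {st : Fin k → Station} {v : Fin k} :
    v ∈ members st ↔ ∃ tc s, st v = .member tc s := by
  simp [members]

/-- The transmission slots. -/
def slotChoice {k : ℕ} (st : Fin k → Station) (v : Fin k) : ℕ :=
  match st v with
  | .member _ s => s.choice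
  | _ => 0

/-- The transmission slots after the random choices of a round. -/
noncomputable def drawnChoice {k : ℕ} (st : Fin k → Station) (u : Fin k → unitInterval)
    (v : Fin k) : ℕ :=
  match st v with
  | .member _ s => (s.draw (u v)).choice
  | _ => 0

lemma IsWhite.four_dvd {r : ℕ} (h : IsWhite r) : 4 ∣ r := by
  obtain ⟨x, hx, rfl⟩ := h
  exact pow_dvd_pow 2 hx

lemma IsWhite.even {r : ℕ} (h : IsWhite r) : Even r := by
  have := h.four_dvd
  rw [Nat.even_iff]; omega

lemma not_isWhite_zero : ¬ IsWhite 0 := by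
  rintro ⟨x, _, h⟩
  exact absurd h.symm (by positivity)

lemma QuietFor.succ {i tc : ℕ} (h : QuietFor i tc) (ht : ¬ (Even tc ∧ ¬ IsWhite tc)) :
    QuietFor (i + 1) (tc + 1) := by
  intro r hr hr'
  rcases Nat.lt_succ_iff_lt_or_eq.1 hr with h1 | rfl
  · exact h r h1 (by omega)
  · exact ht

/-- Multiples of four are the only candidates for white rounds, so a round `≡ 2` modulo `4` is never
quiet. Four consecutive quiet rounds are thus impossible, and a waiting station never completes a
silent block. -/
lemma QuietFor.lt_three {i tc : ℕ} (h : QuietFor i tc) (htc : 1 ≤ tc)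
    (ht : ¬ (Even tc ∧ ¬ IsWhite tc)) : i < 3 := by
  by_contra! hi
  have key : ∀ r, r ≤ tc → tc ≤ r + 3 → ¬ (Even r ∧ ¬ IsWhite r) := fun r h1 h2 => by
    rcases h1.eq_or_lt with rfl | h1
    · exact ht
    · exact h r h1 (by omega)
  have key' : ∀ r, r % 4 = 2 → Even r ∧ ¬ IsWhite r := fun r h1 =>
    ⟨Nat.even_iff.2 (by omega), fun h2 => by have := h2.four_dvd; omega⟩
  by_cases h3 : tc ≤ 1
  -- Round `0`, the election itself, counts as heard: it is even and not white.
  · exact key 0 (by omega) (by omega) ⟨by simp, not_isWhite_zero⟩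
  · by_cases h4 : tc = 2
    · exact key 2 (by omega) (by omega) (key' 2 rfl)
    · have h5 : tc % 4 < 4 := Nat.mod_lt _ (by norm_num)
      -- The last round up to `tc` that is `2` modulo `4`.
      exact key (tc - (tc + 2) % 4) (by omega) (by omega) (key' _ (by omega))

lemma quietFor_zero (tc : ℕ) : QuietFor 0 tc := fun r h1 h2 => by omega

/-- Waiting stations keep waiting as long as they do not hear a control message that ends the
dissemination mode. -/
lemma next_wait {i : ℕ} {heard : Bool} {tc : ℕ} {u : unitInterval} {f : Feedback}
    (hi : heard = false → QuietFor i tc) (htc : 1 ≤ tc)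
    (hf : (∃ m, f = .received m ∧ m ≠ .anybody) ∨
      ((∀ m, f ≠ .received m) ∧ ¬ (Even tc ∧ ¬ IsWhite tc))) :
    ∃ i' heard', (Station.wait i heard).next u f = .wait i' heard' ∧
      (heard' = false → QuietFor i' (tc + 1)) := by
  rcases hf with ⟨m, rfl, hm⟩ | ⟨hf, ht⟩
  · have : (Station.wait i heard).next u (.received m)
        = if i + 1 < 4 then .wait (i + 1) true else .wait 0 false := by
      cases m <;> first | rfl | exact absurd rfl hm
    rw [this]
    split_ifs
    · exact ⟨_, _, rfl, by simp⟩
    · exact ⟨_, _, rfl, fun _ => quietFor_zero _⟩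
  · have : (Station.wait i heard).next u f
        = if i + 1 < 4 then .wait (i + 1) heard
          else if heard then .wait 0 false else .elect 0 := by
      cases f with
      | nothing => rfl
      | ack => rfl
      | received m => exact absurd rfl (hf m)
    rw [this]
    split_ifs with h1 h2
    · exact ⟨_, _, rfl, fun h => (hi h).succ ht⟩
    · exact ⟨_, _, rfl, fun _ => quietFor_zero _⟩
    · have := (hi (by simpa using h2)).lt_three htc ht
      omega

/-! ### Election rounds. -/

section Rounds

variable {k : ℕ} {q : ℝ} {A : Finset (Fin k)} {st : Fin k → Station} {u : Fin k → unitInterval}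

/-- The weight of a sleeping or waiting station does not grow. -/
lemma weight_wait_next (N c i : ℕ) (heard : Bool) (x : unitInterval) (f : Feedback) :
    weight q N c ((Station.wait i heard).next x f) ≤ weight q N c (.wait i heard) := by
  have h : ∃ i' b, (Station.wait i heard).next x f = .wait i' b ∨
      (Station.wait i heard).next x f = .elect 0 := by
    cases f with
    | nothing => simp only [Station.next]; split_ifs <;> simp
    | ack => simp only [Station.next]; split_ifs <;> simp
    | received m => cases m <;> simp only [Station.next] <;> (try split_ifs) <;> simp
  obtain ⟨i', b, h | h⟩ := h <;> rw [h] <;> simp [weight]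

lemma weight_asleep_step (N c : ℕ) {v : Fin k} (h : st v = .asleep) :
    weight q N c (stepStates q A st u v) ≤ weight q N c (st v) := by
  rcases stepStates_asleep q A st u h with h1 | h1 <;> simp [h1, h, weight]

lemma election_isSome_iff (hst : IsElection st) (v : Fin k) :
    v ∈ transmitters (sentFrom q st u) ↔
      ∃ i, st v = .elect i ∧ (u v : ℝ) < q / (2 * q + i) := by
  have := hst v
  rw [mem_transmitters, sentFrom]
  cases hv : st v <;> simp_all [Station.send]

lemma election_sent (hst : IsElection st) {v : Fin k}
    (h : v ∈ transmitters (sentFrom q st u)) : sentFrom q st u v = some .packet := by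
  obtain ⟨i, h1, h2⟩ := (election_isSome_iff hst v).1 h
  simp [sentFrom, h1, Station.send, h2]

lemma election_failure_isElection (hst : IsElection st)
    (h : (transmitters (sentFrom q st u)).card ≠ 1) : IsElection (stepStates q A st u) := by
  intro v
  have hv' := hst v
  by_cases hv : st v = .asleep
  · rcases stepStates_asleep q A st u hv with h1 | h1 <;> rw [h1] <;> simp
  · rw [stepStates_of_ne_asleep q A st u hv, feedback_of_card_ne_one h]
    cases hs : st v <;> simp_all [Station.next]
    split_ifs <;> simp

/-- Passing from iteration `i` to `i + 1` releases exactly the `i`-th term of the prepaid sum,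
whatever the coins are. -/
lemma election_failure_weight (hst : IsElection st) (N c : ℕ)
    (h : (transmitters (sentFrom q st u)).card ≠ 1) (v : Fin k) :
    weight q N c (stepStates q A st u v) + 2 * cutProb q N (st v) ≤ weight q N c (st v) := by
  have hv' := hst v
  by_cases hv : st v = .asleep
  · have := weight_asleep_step (q := q) (A := A) (u := u) N c hv
    rw [show cutProb q N (st v) = 0 by rw [hv]; rfl]
    simpa using this
  · rw [stepStates_of_ne_asleep q A st u hv, feedback_of_card_ne_one h]
    cases hs : st v with
    | asleep => exact absurd hs hv
    | wait i b => simpa [cutProb] using weight_wait_next (q := q) N c i b (u v) .nothing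
    | elect i =>
      rw [weight_elect]
      exact le_rfl
    | lead tc => exact absurd hs (hv'.1 tc)
    | member tc s => exact absurd hs (hv'.2 tc s)
    | off => simp [Station.next, weight, cutProb]

lemma election_success_isDissemination (hst : IsElection st) {l : Fin k}
    (h : transmitters (sentFrom q st u) = {l}) :
    IsDissemination (stepStates q A st u) l 1 0 0 0 := by
  have hl : l ∈ transmitters (sentFrom q st u) := by rw [h]; exact Finset.mem_singleton_self l
  have hs := election_sent hst hl
  obtain ⟨i, hi, _⟩ := (election_isSome_iff hst l).1 hl
  refine ⟨le_rfl, le_rfl, by norm_num, ?_, fun v hvl => ?_⟩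
  · rw [stepStates_of_ne_asleep q A st u (by simp [hi]), feedback_self h hs, hi]
    rfl
  · by_cases hv : st v = .asleep
    · rcases stepStates_asleep q A st u hv with h1 | h1 <;> rw [h1]
      · trivial
      · exact fun _ => quietFor_zero _
    · have hv' := hst v
      rw [stepStates_of_ne_asleep q A st u hv, feedback_other h hs hvl]
      cases hsv : st v with
      | asleep => exact absurd hsv hv
      | wait i b =>
        simp only [Station.next]
        split_ifs
        · simp [IsFollower]
        · exact fun _ => quietFor_zero _
      | elect i => exact ⟨rfl, rfl, rfl, rfl⟩
      | lead tc => exact absurd hsv (hv'.1 tc)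
      | member tc s => exact absurd hsv (hv'.2 tc s)
      | off => trivial

/-- The new leader and all new non-leaders were electing and now have weight `0`. Each releases `c +
2` besides its current election term; the `c`'s finance the dissemination mode, and a single `2`
pays for the success. -/
lemma election_success_weight (hst : IsElection st) {l : Fin k}
    (h : transmitters (sentFrom q st u) = {l}) (X K N : ℕ) :
    ∑ v, weight q N (100 + X + K * (K + 113)) (stepStates q A st u v)
        + phaseCost X K 1 0 0 0 (members (stepStates q A st u)) (slotChoice (stepStates q A st u))
        + 2 + 2 * ∑ v, cutProb q N (st v)
      ≤ ∑ v, weight q N (100 + X + K * (K + 113)) (st v) := by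
  classical
  set c := 100 + X + K * (K + 113) with hc
  have hl : l ∈ transmitters (sentFrom q st u) := by rw [h]; exact Finset.mem_singleton_self l
  have hs := election_sent hst hl
  obtain ⟨i, hi, _⟩ := (election_isSome_iff hst l).1 hl
  set E : Finset (Fin k) := insert l (members (stepStates q A st u)) with hE
  have hlm : l ∉ members (stepStates q A st u) := by
    rw [mem_members, (election_success_isDissemination hst h).leader]
    simp
  have hEc : E.card = (members (stepStates q A st u)).card + 1 := Finset.card_insert_of_notMem hlm
  have hpt : ∀ v, weight q N c (stepStates q A st u v) + 2 * cutProb q N (st v)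
      + (if v ∈ E then (c : ℝ≥0∞) + 2 else 0) ≤ weight q N c (st v) := by
    intro v
    by_cases hvl : v = l
    · rw [if_pos (by simp [hE, hvl]), hvl, (election_success_isDissemination hst h).leader, hi,
        weight_elect]
      simp only [weight, zero_add]
      rw [add_comm]
      exact add_le_add le_self_add le_rfl
    by_cases hv : st v = .asleep
    · have h1 : v ∉ E := by
        simp only [hE, Finset.mem_insert, hvl, mem_members, false_or]
        rcases stepStates_asleep q A st u hv with h1 | h1 <;> rw [h1] <;> simp
      rw [if_neg h1]
      have := weight_asleep_step (q := q) (A := A) (u := u) N c hv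
      rw [show cutProb q N (st v) = 0 by rw [hv]; rfl]
      simpa using this
    · have hv' := hst v
      have hstep := stepStates_of_ne_asleep q A st u hv
      rw [feedback_other h hs hvl] at hstep
      cases hsv : st v with
      | asleep => exact absurd hsv hv
      | wait i b =>
        rw [hsv] at hstep
        have h1 : v ∉ E := by
          simp only [hE, Finset.mem_insert, hvl, mem_members, false_or, hstep, Station.next]
          split_ifs <;> simp
        rw [if_neg h1, hstep]
        simpa [cutProb] using weight_wait_next (q := q) N c i b (u v) _
      | elect i =>
        rw [hsv] at hstep
        rw [hstep, weight_elect]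
        simp only [weight, Station.next, zero_add]
        rw [add_comm]
        refine add_le_add ?_ le_rfl
        refine le_trans ?_ le_self_add
        split_ifs <;> simp
      | lead tc => exact absurd hsv (hv'.1 tc)
      | member tc s => exact absurd hsv (hv'.2 tc s)
      | off =>
        rw [hsv] at hstep
        have h1 : v ∉ E := by
          simp [hE, Finset.mem_insert, hvl, mem_members, hstep, Station.next]
        rw [if_neg h1, hstep]
        simp [Station.next, weight, cutProb]
  have hphase : (phaseCost X K 1 0 0 0 (members (stepStates q A st u))
      (slotChoice (stepStates q A st u)) : ℝ≥0∞) + 2 ≤ E.card * ((c : ℝ≥0∞) + 2) := by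
    have h1 := phaseCost_start_le X K (members (stepStates q A st u))
      (slotChoice (stepStates q A st u))
    rw [← hc, ← hEc] at h1
    have h2 : phaseCost X K 1 0 0 0 (members (stepStates q A st u))
      (slotChoice (stepStates q A st u)) + 2 ≤ E.card * (c + 2) := by
      rw [mul_add, mul_comm E.card c]
      omega
    exact_mod_cast h2
  calc _ = ∑ v, weight q N c (stepStates q A st u v) + 2 * ∑ v, cutProb q N (st v)
        + ((phaseCost X K 1 0 0 0 (members (stepStates q A st u))
            (slotChoice (stepStates q A st u)) : ℝ≥0∞) + 2) := by ring
    _ ≤ ∑ v, weight q N c (stepStates q A st u v) + 2 * ∑ v, cutProb q N (st v)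
        + E.card * ((c : ℝ≥0∞) + 2) := by gcongr
    _ = ∑ v, (weight q N c (stepStates q A st u v) + 2 * cutProb q N (st v)
        + (if v ∈ E then (c : ℝ≥0∞) + 2 else 0)) := by
        rw [Finset.sum_add_distrib, Finset.sum_add_distrib, Finset.mul_sum, Finset.sum_ite_mem,
          Finset.univ_inter, Finset.sum_const, nsmul_eq_mul]
    _ ≤ _ := Finset.sum_le_sum fun v _ => hpt v

end Rounds

/-! ### Dissemination rounds. -/

namespace Saw

lemma draw_pos (s : Saw) (u : unitInterval) : (s.draw u).pos = s.pos := by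
  unfold draw; split_ifs <;> rfl

lemma draw_eq (s : Saw) (u : unitInterval) :
    s.draw u = ⟨s.outer, s.inner, s.pos, (s.draw u).choice⟩ := by
  unfold draw; split_ifs <;> rfl

lemma draw_choice_of_pos_eq_zero {s : Saw} (h : s.pos = 0) (u : unitInterval) :
    (s.draw u).choice = slotOf s.inner u := by
  simp [draw, h, slotOf]

lemma draw_choice_of_pos_ne_zero {s : Saw} (h : s.pos ≠ 0) (u : unitInterval) :
    (s.draw u).choice = s.choice := by
  simp [draw, h]

lemma advance_eq (o j p x : ℕ) :
    advance ⟨o, j, p, x⟩ = ⟨(advance ⟨o, j, p, 0⟩).outer, (advance ⟨o, j, p, 0⟩).inner,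
      (advance ⟨o, j, p, 0⟩).pos, x⟩ := by
  unfold advance
  split_ifs <;> rfl

lemma advance_inner_le {o j : ℕ} (p x : ℕ) (h : j ≤ o) :
    (advance ⟨o, j, p, x⟩).inner ≤ (advance ⟨o, j, p, x⟩).outer := by
  unfold advance
  split_ifs <;> simp <;> omega

lemma advance_pos_lt (o j p x : ℕ) :
    (advance ⟨o, j, p, x⟩).pos < 2 ^ (advance ⟨o, j, p, x⟩).inner := by
  unfold advance
  split_ifs with h1 h2
  · exact h1
  · exact Nat.two_pow_pos _
  · exact Nat.two_pow_pos _

end Saw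

section Dissemination

variable {k : ℕ} {q : ℝ} {A : Finset (Fin k)} {st : Fin k → Station} {u : Fin k → unitInterval}
  {l : Fin k} {tc o j p : ℕ}

lemma weight_next_le (N c : ℕ) {s : Station} (x : unitInterval) (f : Feedback)
    (h : ∀ i, s ≠ .elect i) : weight q N c (s.next x f) ≤ weight q N c s := by
  cases s with
  | asleep => exact le_rfl
  | wait i b => exact weight_wait_next N c i b x f
  | elect i => exact absurd rfl (h i)
  | lead t =>
    cases f <;> simp only [Station.next] <;> (try split_ifs) <;> simp [weight]
  | member t s =>
    cases f <;> simp only [Station.next] <;> (try split_ifs) <;> simp [weight]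
  | off => simp [Station.next, weight]

namespace IsDissemination

lemma ne_elect (h : IsDissemination st l tc o j p) (v : Fin k) (i : ℕ) : st v ≠ .elect i := by
  intro hv
  by_cases hvl : v = l
  · subst hvl; rw [h.leader] at hv; cases hv
  · have := h.follower v hvl
    rw [hv] at this
    exact this

lemma weight_le (h : IsDissemination st l tc o j p) (N c : ℕ) (v : Fin k) :
    weight q N c (stepStates q A st u v) ≤ weight q N c (st v) := by
  by_cases hv : st v = .asleep
  · exact weight_asleep_step N c hv
  · rw [stepStates_of_ne_asleep q A st u hv]
    exact weight_next_le N c _ _ (h.ne_elect v)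

lemma leader_notMem (h : IsDissemination st l tc o j p) : l ∉ members st := by
  rw [mem_members, h.leader]; simp

lemma eq_member (h : IsDissemination st l tc o j p) {v : Fin k} (hv : v ∈ members st) :
    st v = .member tc ⟨o, j, p, slotChoice st v⟩ := by
  obtain ⟨t, s, hs⟩ := mem_members.1 hv
  have hvl : v ≠ l := fun hvl => h.leader_notMem (hvl ▸ hv)
  have := h.follower v hvl
  rw [hs] at this
  obtain ⟨rfl, rfl, rfl, rfl⟩ := this
  simp [slotChoice, hs]

/-- Stations that are neither the leader nor active non-leaders. -/
lemma step_idle (h : IsDissemination st l tc o j p) {v : Fin k} (hvl : v ≠ l)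
    (hv : v ∉ members st)
    (hf : (∃ m, feedback (sentFrom q st u) v = .received m ∧ m ≠ .anybody) ∨
      ((∀ m, feedback (sentFrom q st u) v ≠ .received m) ∧ ¬ (Even tc ∧ ¬ IsWhite tc)))
    (o' j' p' : ℕ) :
    IsFollower (tc + 1) o' j' p' (stepStates q A st u v) ∧ v ∉ members (stepStates q A st u) := by
  have hfv := h.follower v hvl
  by_cases hs : st v = .asleep
  · rw [mem_members]
    rcases stepStates_asleep q A st u hs with h1 | h1 <;> rw [h1]
    · exact ⟨trivial, by simp⟩
    · exact ⟨fun _ => quietFor_zero _, by simp⟩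
  · rw [mem_members, stepStates_of_ne_asleep q A st u hs]
    cases hsv : st v with
    | asleep => exact absurd hsv hs
    | wait i b =>
      rw [hsv] at hfv
      obtain ⟨i', b', h1, h2⟩ := next_wait (u := u v) hfv h.pos hf
      rw [h1]
      exact ⟨h2, by simp⟩
    | elect i => exact absurd hsv (h.ne_elect v i)
    | lead t => rw [hsv] at hfv; exact hfv.elim
    | member t s => exact absurd (mem_members.2 ⟨t, s, hsv⟩) hv
    | off => exact ⟨trivial, by simp [Station.next]⟩

lemma mem_transmitters_of_odd (h : IsDissemination st l tc o j p) (ht : Odd tc) (v : Fin k) :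
    v ∈ transmitters (sentFrom q st u) ↔ v ∈ members st ∧ drawnChoice st u v = p := by
  by_cases hvl : v = l
  · subst hvl
    rw [mem_transmitters, sentFrom, h.leader]
    simp [Station.send, ht, h.leader_notMem]
  by_cases hv : v ∈ members st
  · simp only [mem_transmitters, sentFrom, hv, true_and, drawnChoice]
    rw [h.eq_member hv]
    simp only [Station.send, ht, if_true, Saw.draw_pos, eq_comm (a := p)]
    split_ifs with h1 <;> simp [h1]
  · have := h.follower v hvl
    simp only [mem_transmitters, sentFrom, hv, false_and, iff_false]
    rw [mem_members] at hv
    cases hs : st v <;> simp_all [Station.send, IsFollower]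

lemma sent_of_odd (h : IsDissemination st l tc o j p) (ht : Odd tc) {v : Fin k}
    (hv : v ∈ transmitters (sentFrom q st u)) : sentFrom q st u v = some .packet := by
  have h1 := ((h.mem_transmitters_of_odd ht v).1 hv).1
  rw [mem_transmitters, sentFrom, h.eq_member h1] at hv
  rw [sentFrom, h.eq_member h1]
  simp only [Station.send, ht, if_true] at hv ⊢
  split_ifs with h2
  · rfl
  · rw [if_neg h2] at hv; cases hv

lemma transmitters_of_odd (h : IsDissemination st l tc o j p) (ht : Odd tc) :
    transmitters (sentFrom q st u) = (members st).filter fun v => drawnChoice st u v = p := by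
  ext v
  rw [h.mem_transmitters_of_odd ht, Finset.mem_filter]

/-- In an odd round nobody hears a control message. -/
lemma feedback_of_odd (h : IsDissemination st l tc o j p) (ht : Odd tc) (v : Fin k) :
    (transmitters (sentFrom q st u) = {v} ∧ feedback (sentFrom q st u) v = .ack) ∨
    (transmitters (sentFrom q st u) ≠ {v} ∧
      (feedback (sentFrom q st u) v = .nothing ∨
        feedback (sentFrom q st u) v = .received .packet)) := by
  by_cases h1 : (transmitters (sentFrom q st u)).card = 1
  · obtain ⟨w, hw⟩ := Finset.card_eq_one.1 h1
    have hs : sentFrom q st u w = some .packet :=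
      h.sent_of_odd ht (by rw [hw]; exact Finset.mem_singleton_self w)
    by_cases hvw : v = w
    · subst hvw
      exact Or.inl ⟨hw, feedback_self hw hs⟩
    · refine Or.inr ⟨fun hv => hvw ?_, Or.inr (feedback_other hw hs hvw)⟩
      exact (Finset.singleton_injective (hw.symm.trans hv)).symm
  · refine Or.inr ⟨fun hv => h1 (by rw [hv, Finset.card_singleton]), Or.inl ?_⟩
    exact feedback_of_card_ne_one h1 v

lemma step_member_of_odd (h : IsDissemination st l tc o j p) (ht : Odd tc) {v : Fin k}
    (hv : v ∈ members st) :
    stepStates q A st u v = if v ∈ afterSlot p (members st) (drawnChoice st u)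
      then .member (tc + 1) (Saw.advance ⟨o, j, p, drawnChoice st u v⟩) else .off := by
  have hs := h.eq_member hv
  have hiff : transmitters (sentFrom q st u) = {v} ↔
      v ∉ afterSlot p (members st) (drawnChoice st u) := by
    rw [h.transmitters_of_odd ht, mem_afterSlot, not_and, not_not, Finset.ext_iff]
    simp only [Finset.mem_filter, Finset.mem_singleton]
    constructor
    · intro h1 _
      have h2 := ((h1 v).2 rfl).2
      exact ⟨h2, fun w hw hwv => (h1 w).1 ⟨hw, hwv.trans h2⟩⟩
    · intro h1 w
      obtain ⟨h2, h3⟩ := h1 hv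
      exact ⟨fun hw => h3 w hw.1 (hw.2.trans h2.symm), fun hw => hw ▸ ⟨hv, h2⟩⟩
  have hd : (Saw.draw ⟨o, j, p, slotChoice st v⟩ (u v)) = ⟨o, j, p, drawnChoice st u v⟩ := by
    rw [Saw.draw_eq]
    simp only [drawnChoice]
    rw [hs]
  rw [stepStates_of_ne_asleep q A st u (by simp [hs]), hs]
  rcases h.feedback_of_odd (q := q) (u := u) ht v with ⟨h1, h2⟩ | ⟨h1, h2⟩
  · rw [if_neg (hiff.1 h1), h2]
    simp [Station.next, ht]
  · rw [if_pos (by rw [Ne, hiff, not_not] at h1; exact h1)]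
    rcases h2 with h2 | h2 <;> rw [h2] <;> simp [Station.next, ht, hd]

lemma members_step_of_odd (h : IsDissemination st l tc o j p) (ht : Odd tc) :
    members (stepStates q A st u) = afterSlot p (members st) (drawnChoice st u) := by
  ext v
  by_cases hv : v ∈ members st
  · rw [mem_members, h.step_member_of_odd ht hv]
    split_ifs with h1 <;> simp [h1]
  · refine iff_of_false ?_ fun h1 => hv (afterSlot_subset _ _ _ h1)
    by_cases hvl : v = l
    · subst hvl
      rw [mem_members, stepStates_of_ne_asleep q A st u (by simp [h.leader]), h.leader]
      cases feedback (sentFrom q st u) v <;> simp only [Station.next] <;> (try split_ifs) <;> simp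
    · have hodd : ¬ (Even tc ∧ ¬ IsWhite tc) := fun h1 => Nat.not_even_iff_odd.2 ht h1.1
      refine (h.step_idle hvl hv ?_ 0 0 0).2
      rcases h.feedback_of_odd (q := q) (u := u) ht v with ⟨_, h2⟩ | ⟨_, h2 | h2⟩ <;> rw [h2]
      · exact Or.inr ⟨by simp, hodd⟩
      · exact Or.inr ⟨by simp, hodd⟩
      · exact Or.inl ⟨_, rfl, by simp⟩

lemma step_of_odd (h : IsDissemination st l tc o j p) (ht : Odd tc) :
    IsDissemination (stepStates q A st u) l (tc + 1) (Saw.advance ⟨o, j, p, 0⟩).outer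
      (Saw.advance ⟨o, j, p, 0⟩).inner (Saw.advance ⟨o, j, p, 0⟩).pos := by
  refine ⟨by omega, Saw.advance_inner_le _ _ h.inner_le, Saw.advance_pos_lt _ _ _ _, ?_,
    fun v hvl => ?_⟩
  · rw [stepStates_of_ne_asleep q A st u (by simp [h.leader]), h.leader]
    rcases h.feedback_of_odd (q := q) (u := u) ht l with ⟨h1, _⟩ | ⟨_, h2 | h2⟩
    · refine absurd ?_ h.leader_notMem
      refine ((h.mem_transmitters_of_odd (q := q) (u := u) ht l).1 ?_).1
      rw [h1]
      exact Finset.mem_singleton_self l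
    · rw [h2]; rfl
    · rw [h2]; rfl
  · by_cases hv : v ∈ members st
    · rw [h.step_member_of_odd ht hv]
      split_ifs
      · rw [Saw.advance_eq o j p (drawnChoice st u v)]
        exact ⟨rfl, rfl, rfl, rfl⟩
      · trivial
    · have hodd : ¬ (Even tc ∧ ¬ IsWhite tc) := fun h1 => Nat.not_even_iff_odd.2 ht h1.1
      refine (h.step_idle hvl hv ?_ _ _ _).1
      rcases h.feedback_of_odd (q := q) (u := u) ht v with ⟨_, h2⟩ | ⟨_, h2 | h2⟩ <;> rw [h2]
      · exact Or.inr ⟨by simp, hodd⟩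
      · exact Or.inr ⟨by simp, hodd⟩
      · exact Or.inl ⟨_, rfl, by simp⟩

lemma slotChoice_step_of_odd (h : IsDissemination st l tc o j p) (ht : Odd tc) {v : Fin k}
    (hv : v ∈ members (stepStates q A st u)) :
    slotChoice (stepStates q A st u) v = drawnChoice st u v := by
  rw [h.members_step_of_odd ht] at hv
  rw [slotChoice, h.step_member_of_odd ht (afterSlot_subset _ _ _ hv), if_pos hv, Saw.advance_eq]

lemma mem_transmitters_of_even (h : IsDissemination st l tc o j p) (ht : Even tc) (v : Fin k) :
    v ∈ transmitters (sentFrom q st u) ↔ v = l ∨ (IsWhite tc ∧ v ∈ members st) := by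
  have ht' : ¬ Odd tc := Nat.not_odd_iff_even.2 ht
  by_cases hvl : v = l
  · subst hvl
    rw [mem_transmitters, sentFrom, h.leader]
    simp only [Station.send, ht', if_false, true_or, iff_true]
    split_ifs <;> rfl
  by_cases hv : v ∈ members st
  · simp only [mem_transmitters, sentFrom, hv, and_true, hvl, false_or]
    rw [h.eq_member hv]
    simp only [Station.send, ht', if_false]
    split_ifs with h1 <;> simp [h1]
  · have := h.follower v hvl
    simp only [mem_transmitters, sentFrom, hv, and_false, hvl, or_false, iff_false]
    rw [mem_members] at hv
    cases hs : st v <;> simp_all [Station.send, IsFollower]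

lemma transmitters_of_even (h : IsDissemination st l tc o j p) (ht : Even tc)
    (hw : IsWhite tc → members st = ∅) : transmitters (sentFrom q st u) = {l} := by
  ext v
  rw [h.mem_transmitters_of_even ht, Finset.mem_singleton]
  refine ⟨fun h1 => h1.elim id fun h2 => ?_, Or.inl⟩
  rw [hw h2.1] at h2
  simp at h2

lemma card_transmitters_of_white (h : IsDissemination st l tc o j p) (hw : IsWhite tc) :
    (transmitters (sentFrom q st u)).card = (members st).card + 1 := by
  classical
  rw [← Finset.card_insert_of_notMem h.leader_notMem]
  congr 1
  ext v
  rw [h.mem_transmitters_of_even hw.even, Finset.mem_insert]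
  simp [hw]

/-- In an even round that does not end the dissemination mode the state of the back-off protocol
is not changed. -/
lemma step_of_even_aux (h : IsDissemination st l tc o j p) (ht : Even tc)
    (hl : (Station.lead tc).next (u l) (feedback (sentFrom q st u) l) = .lead (tc + 1))
    (hf : ∀ v ≠ l, (feedback (sentFrom q st u) v = .received .dmode) ∨
      (feedback (sentFrom q st u) v = .nothing ∧ IsWhite tc)) :
    IsDissemination (stepStates q A st u) l (tc + 1) o j p ∧
      members (stepStates q A st u) = members st ∧
      ∀ v ∈ members st, slotChoice (stepStates q A st u) v = slotChoice st v := by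
  have hodd : ¬ Odd tc := Nat.not_odd_iff_even.2 ht
  have hlead : stepStates q A st u l = .lead (tc + 1) := by
    rw [stepStates_of_ne_asleep q A st u (by simp [h.leader]), h.leader, hl]
  have hmem : ∀ v ∈ members st,
      stepStates q A st u v = .member (tc + 1) ⟨o, j, p, slotChoice st v⟩ := fun v hv => by
    have hs := h.eq_member hv
    have hvl : v ≠ l := fun hvl => h.leader_notMem (hvl ▸ hv)
    rw [stepStates_of_ne_asleep q A st u (by simp [hs]), hs]
    rcases hf v hvl with h1 | ⟨h1, _⟩ <;> rw [h1] <;> simp [Station.next, hodd]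
  have hidle : ∀ v ≠ l, v ∉ members st → IsFollower (tc + 1) o j p (stepStates q A st u v) ∧
      v ∉ members (stepStates q A st u) := fun v hvl hv => by
    refine h.step_idle hvl hv ?_ o j p
    rcases hf v hvl with h1 | ⟨h1, h2⟩ <;> rw [h1]
    · exact Or.inl ⟨_, rfl, by simp⟩
    · exact Or.inr ⟨by simp, fun h3 => h3.2 h2⟩
  refine ⟨⟨by omega, h.inner_le, h.slot_lt, hlead, fun v hvl => ?_⟩, ?_, fun v hv => ?_⟩
  · by_cases hv : v ∈ members st
    · rw [hmem v hv]
      exact ⟨rfl, rfl, rfl, rfl⟩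
    · exact (hidle v hvl hv).1
  · ext v
    by_cases hv : v ∈ members st
    · simp only [hv, iff_true, mem_members, hmem v hv]
      exact ⟨_, _, rfl⟩
    · refine iff_of_false ?_ hv
      by_cases hvl : v = l
      · rw [mem_members, hvl, hlead]; simp
      · exact (hidle v hvl hv).2
  · simp [slotChoice, hmem v hv]

/-- In a white round a remaining non-leader collides with the leader, so nobody hears the query; in
any other even round everybody but the leader hears `<D mode>`. -/
lemma step_of_even (h : IsDissemination st l tc o j p) (ht : Even tc)
    (hw : IsWhite tc → (members st).Nonempty) :
    IsDissemination (stepStates q A st u) l (tc + 1) o j p ∧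
      members (stepStates q A st u) = members st ∧
      ∀ v ∈ members st, slotChoice (stepStates q A st u) v = slotChoice st v := by
  have hodd : ¬ Odd tc := Nat.not_odd_iff_even.2 ht
  by_cases hwt : IsWhite tc
  · have h1 : (transmitters (sentFrom q st u)).card ≠ 1 := by
      rw [h.card_transmitters_of_white hwt]
      have := (hw hwt).card_pos
      omega
    refine h.step_of_even_aux ht ?_ fun v _ => Or.inr ⟨feedback_of_card_ne_one h1 v, hwt⟩
    rw [feedback_of_card_ne_one h1]
    rfl
  · have h1 := h.transmitters_of_even (q := q) (u := u) ht fun h2 => absurd h2 hwt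
    have h2 : sentFrom q st u l = some .dmode := by
      simp [sentFrom, h.leader, Station.send, hodd, hwt]
    refine h.step_of_even_aux ht ?_ fun v hvl => Or.inl (feedback_other h1 h2 hvl)
    rw [feedback_self h1 h2]
    simp [Station.next, hwt]

/-- If all non-leaders have switched off, the next white round ends the dissemination mode. -/
lemma step_of_white (h : IsDissemination st l tc o j p) (hw : IsWhite tc)
    (hM : members st = ∅) : IsElection (stepStates q A st u) := by
  have hodd : ¬ Odd tc := Nat.not_odd_iff_even.2 hw.even
  have h1 := h.transmitters_of_even (q := q) (u := u) hw.even fun _ => hM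
  have h2 : sentFrom q st u l = some .anybody := by
    simp [sentFrom, h.leader, Station.send, hodd, hw]
  intro v
  by_cases hvl : v = l
  · subst hvl
    rw [stepStates_of_ne_asleep q A st u (by simp [h.leader]), h.leader, feedback_self h1 h2]
    simp [Station.next, hw]
  by_cases hv : st v = .asleep
  · rcases stepStates_asleep q A st u hv with h3 | h3 <;> rw [h3] <;> simp
  · have hf := h.follower v hvl
    have hm : v ∉ members st := by rw [hM]; simp
    rw [mem_members] at hm
    rw [stepStates_of_ne_asleep q A st u hv, feedback_other h1 h2 hvl]
    cases hs : st v <;> simp_all [Station.next, IsFollower]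

end IsDissemination

end Dissemination

/-! ### The potential and its decrease in expectation. -/

section Potential

variable {k : ℕ} {q : ℝ} {A : Finset (Fin k)} {st : Fin k → Station} {u : Fin k → unitInterval}
  {l : Fin k} {tc o j p : ℕ}

/-- The potential: a bound on the expected number of transmissions that are still to come. -/
noncomputable def potential (q : ℝ) (N X K : ℕ) (st : Fin k → Station) : ℝ≥0∞ :=
  (⨅ (_ : IsElection st), ∑ v, weight q N (100 + X + K * (K + 113)) (st v)) ⊓
    ⨅ (l : Fin k) (tc : ℕ) (o : ℕ) (j : ℕ) (p : ℕ) (_ : IsDissemination st l tc o j p),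
      (∑ v, weight q N (100 + X + K * (K + 113)) (st v)
        + phaseCost X K tc o j p (members st) (slotChoice st))

lemma potential_le_of_isElection (N X K : ℕ) (h : IsElection st) :
    potential q N X K st ≤ ∑ v, weight q N (100 + X + K * (K + 113)) (st v) :=
  inf_le_left.trans (iInf_le _ h)

lemma potential_le_of_isDissemination (N X K : ℕ) (h : IsDissemination st l tc o j p) :
    potential q N X K st ≤ ∑ v, weight q N (100 + X + K * (K + 113)) (st v)
      + phaseCost X K tc o j p (members st) (slotChoice st) :=
  inf_le_right.trans (iInf_le_of_le l (iInf_le_of_le tc (iInf_le_of_le o (iInf_le_of_le j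
    (iInf_le_of_le p (iInf_le_of_le h le_rfl))))))

/-- If `P ≤ 1/2`, then `P * P ≤ P / 2` and `h1` gives `P ≤ 2R`. If `P ≥ 1/2`, then `1/4 ≤ P / 2` and
`h2` gives `P ≤ 2C`. -/
lemma le_two_mul_of_le_add_sq {P R C : ℝ≥0∞} (hP : P ≠ ∞) (h1 : P ≤ R + P * P)
    (h2 : P ≤ C + 4⁻¹) : P ≤ 2 * C + 2 * R := by
  rcases le_total P 2⁻¹ with h | h
  · refine le_add_left ((ENNReal.add_le_add_iff_right hP).1 ?_)
    calc P + P = 2 * P := (two_mul P).symm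
      _ ≤ 2 * (R + 2⁻¹ * P) := by gcongr; exact h1.trans (by gcongr)
      _ = 2 * R + P := by
        rw [mul_add, ← mul_assoc, ENNReal.mul_inv_cancel (by simp) (by simp), one_mul]
  · refine le_add_right ((ENNReal.add_le_add_iff_right hP).1 ?_)
    have h4 : (2 : ℝ≥0∞) * 4⁻¹ = 2⁻¹ := by
      rw [show (4 : ℝ≥0∞) = 2 * 2 by norm_num, ENNReal.mul_inv (by simp) (by simp), ← mul_assoc,
        ENNReal.mul_inv_cancel (by simp) (by simp), one_mul]
    calc P + P = 2 * P := (two_mul P).symm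
      _ ≤ 2 * (C + 4⁻¹) := by gcongr
      _ = 2 * C + 2⁻¹ := by rw [mul_add, h4]
      _ ≤ 2 * C + P := by gcongr

lemma electProb_le_of_le (hq : 0 < q) {i i' : ℕ} (h : i ≤ i') :
    electProb q i' ≤ electProb q i := by
  refine ENNReal.ofReal_le_ofReal ?_
  have : (i : ℝ) ≤ i' := by exact_mod_cast h
  gcongr

/-- The random numbers with which a station transmits in an election round. -/
def electSet (q : ℝ) (s : Station) : Set unitInterval :=
  {x | ∃ i, s = .elect i ∧ (x : ℝ) < q / (2 * q + i)}

lemma electSet_elect (i : ℕ) : electSet q (.elect i) = {x : unitInterval | (x : ℝ) < q / (2 * q + i)} := by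
  ext x; simp [electSet]

lemma measurableSet_electSet (s : Station) : MeasurableSet (electSet q s) := by
  cases s with
  | elect i =>
    rw [electSet_elect]
    exact measurableSet_lt measurable_subtype_coe measurable_const
  | _ => simp [electSet]

/-- Transmission probabilities decrease with the iteration, so past the cut-off each is at most
`electProb q N`. -/
lemma volume_electSet_le (hq : 0 < q) (N : ℕ) (s : Station) :
    volume (electSet q s) ≤ cutProb q N s + electProb q N := by
  cases s with
  | elect i =>
    rw [electSet_elect]
    refine (volume_coe_lt_le _).trans ?_
    change electProb q i ≤ _
    simp only [cutProb]
    split_ifs with h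
    · exact le_self_add
    · exact le_add_left (electProb_le_of_le hq (by omega))
  | _ => simp [electSet]

/-- The expected number of transmissions is at most `2C + 2R`. The weights fall by `2C` for certain,
and by a further `2` beyond the cost of the new mode if the election succeeds. -/
lemma lintegral_step_election (hq : 0 < q) {N : ℕ} (X K : ℕ)
    (hN : k * electProb q N ≤ 4⁻¹) (hst : IsElection st) :
    ∫⁻ u, ((transmitters (sentFrom q st u)).card + potential q N X K (stepStates q A st u))
        ∂(roundLaw k)
      ≤ ∑ v, weight q N (100 + X + K * (K + 113)) (st v) := by
  have hA : ∀ v, MeasurableSet (electSet q (st v)) := fun v => measurableSet_electSet _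
  have hm : ∀ v, MeasurableSet {u : Fin k → unitInterval | u v ∈ electSet q (st v)} :=
    fun v => (hA v).preimage (measurable_pi_apply v)
  have hT : ∀ u v, v ∈ transmitters (sentFrom q st u) ↔
      v ∈ (Finset.univ : Finset (Fin k)) ∧ u v ∈ electSet q (st v) := fun u v => by
    rw [election_isSome_iff hst]
    simp [electSet]
  have hcard : ∀ u, ((transmitters (sentFrom q st u)).card : ℝ≥0∞)
      = ∑ v, {u : Fin k → unitInterval | u v ∈ electSet q (st v)}.indicator 1 u := fun u => by
    classical
    have : transmitters (sentFrom q st u) = Finset.univ.filter fun v => u v ∈ electSet q (st v) := by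
      ext v; rw [hT, Finset.mem_filter]
    rw [this, Finset.card_filter, Nat.cast_sum]
    refine Finset.sum_congr rfl fun v _ => ?_
    rw [Set.indicator_apply]
    simp
  have hcm : Measurable fun u => ((transmitters (sentFrom q st u)).card : ℝ≥0∞) := by
    simp_rw [hcard]
    exact Finset.measurable_sum _ fun v _ => measurable_one.indicator (hm v)
  have hone : MeasurableSet {u | (transmitters (sentFrom q st u)).card = 1} := by
    have : {u | (transmitters (sentFrom q st u)).card = 1}
        = (fun u => ((transmitters (sentFrom q st u)).card : ℝ≥0∞)) ⁻¹' {1} := by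
      ext u; simp
    rw [this]
    exact hcm (measurableSet_singleton 1)
  set R := roundLaw k {u | (transmitters (sentFrom q st u)).card = 1}
  set C := ∑ v, cutProb q N (st v)
  have hP : ∫⁻ u, ((transmitters (sentFrom q st u)).card : ℝ≥0∞) ∂(roundLaw k)
      = ∑ v, volume (electSet q (st v)) := by
    simp_rw [hcard]
    rw [lintegral_finsetSum _ fun v _ => measurable_one.indicator (hm v)]
    refine Finset.sum_congr rfl fun v _ => ?_
    rw [lintegral_indicator_one (hm v), roundLaw_eval v (hA v)]
  have hle : ∑ v, volume (electSet q (st v)) ≤ 2 * C + 2 * R := by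
    refine le_two_mul_of_le_add_sq (ENNReal.sum_ne_top.2 fun v _ => measure_ne_top _ _)
      (sum_volume_le_prob_card_eq_one _ _ hA _ hT) ?_
    calc _ ≤ ∑ v, (cutProb q N (st v) + electProb q N) :=
          Finset.sum_le_sum fun v _ => volume_electSet_le hq N (st v)
      _ = C + k * electProb q N := by
          rw [Finset.sum_add_distrib, Finset.sum_const, Finset.card_univ, Fintype.card_fin,
            nsmul_eq_mul]
      _ ≤ C + 4⁻¹ := by gcongr
  have hpt : ∀ u, potential q N X K (stepStates q A st u) + (2 * C
      + 2 * {u | (transmitters (sentFrom q st u)).card = 1}.indicator 1 u)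
      ≤ ∑ v, weight q N (100 + X + K * (K + 113)) (st v) := by
    intro u
    by_cases h : (transmitters (sentFrom q st u)).card = 1
    · rw [Set.indicator_of_mem (by exact h), Pi.one_apply, mul_one]
      obtain ⟨l, hl⟩ := Finset.card_eq_one.1 h
      refine le_trans ?_ (election_success_weight (A := A) hst hl X K N)
      have h1 := potential_le_of_isDissemination (q := q) N X K
        (election_success_isDissemination (A := A) hst hl)
      calc _ ≤ _ := add_le_add h1 le_rfl
        _ = _ := by ring
    · rw [Set.indicator_of_notMem (by exact h), mul_zero, add_zero]
      calc _ ≤ _ := add_le_add (potential_le_of_isElection (q := q) N X K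
            (election_failure_isElection (A := A) hst h)) le_rfl
        _ = ∑ v, (weight q N (100 + X + K * (K + 113)) (stepStates q A st u v)
            + 2 * cutProb q N (st v)) := by rw [Finset.sum_add_distrib, Finset.mul_sum]
        _ ≤ _ := Finset.sum_le_sum fun v _ => election_failure_weight hst N _ h v
  calc _ = ∑ v, volume (electSet q (st v))
        + ∫⁻ u, potential q N X K (stepStates q A st u) ∂(roundLaw k) := by
        rw [lintegral_add_left hcm, hP]
    _ ≤ (2 * C + 2 * R) + ∫⁻ u, potential q N X K (stepStates q A st u) ∂(roundLaw k) := by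
        gcongr
    _ = ∫⁻ u, (potential q N X K (stepStates q A st u) + (2 * C
        + 2 * {u | (transmitters (sentFrom q st u)).card = 1}.indicator 1 u)) ∂(roundLaw k) := by
        have hmeas : Measurable fun u => 2 * C
            + 2 * {u | (transmitters (sentFrom q st u)).card = 1}.indicator 1 u :=
          measurable_const.add ((measurable_one.indicator hone).const_mul 2)
        rw [lintegral_add_right _ hmeas, lintegral_add_left measurable_const,
          lintegral_const_mul _ (measurable_one.indicator hone), lintegral_indicator_one hone,
          lintegral_const, measure_univ, mul_one, add_comm]
    _ ≤ ∫⁻ _, ∑ v, weight q N (100 + X + K * (K + 113)) (st v) ∂(roundLaw k) :=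
        lintegral_mono hpt
    _ = _ := by rw [lintegral_const, measure_univ, mul_one]

lemma drawnChoice_of_pos_ne_zero (h : IsDissemination st l tc o j p) (hp : p ≠ 0) {v : Fin k}
    (hv : v ∈ members st) : drawnChoice st u v = slotChoice st v := by
  rw [drawnChoice, h.eq_member hv]
  exact Saw.draw_choice_of_pos_ne_zero hp _

lemma drawnChoice_of_pos_eq_zero (h : IsDissemination st l tc o j 0) {v : Fin k}
    (hv : v ∈ members st) : drawnChoice st u v = slotOf j (u v) := by
  rw [drawnChoice, h.eq_member hv]
  exact Saw.draw_choice_of_pos_eq_zero rfl _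

lemma step_odd_le (N X K : ℕ) (h : IsDissemination st l tc o j p) (ht : Odd tc) :
    (transmitters (sentFrom q st u)).card + potential q N X K (stepStates q A st u)
      ≤ (∑ v, weight q N (100 + X + K * (K + 113)) (st v)
          + (leadCost tc (members st).card + (members st).card * whitesLeft X tc : ℕ))
        + slotCost K o j p (members st) (drawnChoice st u) := by
  have h1 := potential_le_of_isDissemination (q := q) N X K (h.step_of_odd (q := q) (A := A) (u := u) ht)
  have h2 : phaseCost X K (tc + 1) (Saw.advance ⟨o, j, p, 0⟩).outer
      (Saw.advance ⟨o, j, p, 0⟩).inner (Saw.advance ⟨o, j, p, 0⟩).pos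
      (members (stepStates q A st u)) (slotChoice (stepStates q A st u))
      = phaseCost X K (tc + 1) (Saw.advance ⟨o, j, p, 0⟩).outer
      (Saw.advance ⟨o, j, p, 0⟩).inner (Saw.advance ⟨o, j, p, 0⟩).pos
      (afterSlot p (members st) (drawnChoice st u)) (drawnChoice st u) := by
    unfold phaseCost
    rw [sawCost_congr _ _ _ _ fun v hv => h.slotChoice_step_of_odd ht hv,
      h.members_step_of_odd ht]
  have h3 := phaseCost_odd X K tc o j p 0 (members st) (drawnChoice st u) h.slot_lt ht
  rw [← h.transmitters_of_odd (q := q) ht, ← h2] at h3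
  have h4 : ∑ v, weight q N (100 + X + K * (K + 113)) (stepStates q A st u v)
      ≤ ∑ v, weight q N (100 + X + K * (K + 113)) (st v) :=
    Finset.sum_le_sum fun v _ => h.weight_le N _ v
  refine (add_le_add_right h1 _).trans ?_
  rw [add_left_comm, add_assoc (Finset.sum _ _)]
  refine add_le_add h4 ?_
  exact_mod_cast h3

/-- Randomness enters only at `p = 0`, where the slots of the window are drawn and
`lintegral_slotCost_le` averages over them. For `p ≠ 0` the slots are already fixed. -/
lemma lintegral_step_odd (N X : ℕ) {K : ℕ} (hK : ∀ o, K ≤ o → k * (o + 113) ≤ 14 * 2 ^ o)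
    (h : IsDissemination st l tc o j p) (ht : Odd tc) :
    ∫⁻ u, ((transmitters (sentFrom q st u)).card + potential q N X K (stepStates q A st u))
        ∂(roundLaw k)
      ≤ ∑ v, weight q N (100 + X + K * (K + 113)) (st v)
        + phaseCost X K tc o j p (members st) (slotChoice st) := by
  have hev : ¬ (Even tc ∧ (members st).Nonempty) := fun h1 => Nat.not_even_iff_odd.2 ht h1.1
  refine (lintegral_mono fun u => step_odd_le N X K h ht).trans ?_
  rw [lintegral_add_left measurable_const, lintegral_const, measure_univ, mul_one, add_assoc]
  refine add_le_add le_rfl ?_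
  rw [phaseCost, if_neg hev, add_zero, Nat.cast_add (_ + _)]
  refine add_le_add le_rfl ?_
  by_cases hp : p = 0
  · subst hp
    have h1 : ∀ u, slotCost K o j 0 (members st) (drawnChoice st u)
        = slotCost K o j 0 (members st) fun v => slotOf j (u v) := fun u =>
      slotCost_congr _ _ _ _ fun v hv => drawnChoice_of_pos_eq_zero h hv
    simp_rw [h1]
    exact lintegral_slotCost_le hK h.inner_le _
  · have h1 : ∀ u, slotCost K o j p (members st) (drawnChoice st u)
        = slotCost K o j p (members st) (slotChoice st) := fun u =>
      slotCost_congr _ _ _ _ fun v hv => drawnChoice_of_pos_ne_zero h hp hv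
    simp_rw [h1]
    rw [lintegral_const, measure_univ, mul_one, sawCost, if_neg hp]

/-- Even rounds need no averaging. If a white round finds no non-leader, its one transmission uses
up the last unit of `leadCost` and election states return. -/
lemma step_even_le (N : ℕ) {X : ℕ} (K : ℕ) (hX : k ≤ 2 ^ X) (h : IsDissemination st l tc o j p)
    (ht : Even tc) :
    (transmitters (sentFrom q st u)).card + potential q N X K (stepStates q A st u)
      ≤ ∑ v, weight q N (100 + X + K * (K + 113)) (st v)
        + phaseCost X K tc o j p (members st) (slotChoice st) := by
  have h4 : ∑ v, weight q N (100 + X + K * (K + 113)) (stepStates q A st u v)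
      ≤ ∑ v, weight q N (100 + X + K * (K + 113)) (st v) :=
    Finset.sum_le_sum fun v _ => h.weight_le N _ v
  by_cases hw : IsWhite tc → (members st).Nonempty
  · obtain ⟨h1, h2, h3⟩ := h.step_of_even (q := q) (A := A) (u := u) ht hw
    have h5 := potential_le_of_isDissemination (q := q) N X K h1
    have h6 : phaseCost X K (tc + 1) o j p (members (stepStates q A st u))
        (slotChoice (stepStates q A st u))
        = phaseCost X K (tc + 1) o j p (members st) (slotChoice st) := by
      unfold phaseCost
      rw [h2, sawCost_congr _ _ _ _ h3]
    rw [h6] at h5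
    have h7 : (transmitters (sentFrom q st u)).card
        + phaseCost X K (tc + 1) o j p (members st) (slotChoice st)
        ≤ phaseCost X K tc o j p (members st) (slotChoice st) := by
      by_cases hwt : IsWhite tc
      · rw [h.card_transmitters_of_white hwt]
        exact phaseCost_white X K tc o j p _ _ hwt (hw hwt) hX
      · rw [h.transmitters_of_even ht fun h8 => absurd h8 hwt, Finset.card_singleton]
        exact phaseCost_even X K tc o j p _ _ ht hwt
    refine (add_le_add_right h5 _).trans ?_
    rw [add_left_comm]
    refine add_le_add h4 ?_
    exact_mod_cast h7
  · push Not at hw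
    have hM := hw.2
    rw [h.transmitters_of_even ht fun _ => hM, Finset.card_singleton, hM, add_comm]
    refine add_le_add ((potential_le_of_isElection N X K (h.step_of_white hw.1 hM)).trans h4) ?_
    exact_mod_cast one_le_phaseCost_empty X K tc o j p _

/-- The potential decreases in expectation by at least the number of transmissions. -/
lemma lintegral_step_le (hq : 0 < q) {N X K : ℕ} (hN : k * electProb q N ≤ 4⁻¹)
    (hX : k ≤ 2 ^ X) (hK : ∀ o, K ≤ o → k * (o + 113) ≤ 14 * 2 ^ o)
    (A : Finset (Fin k)) (st : Fin k → Station) :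
    ∫⁻ u, ((transmitters (sentFrom q st u)).card + potential q N X K (stepStates q A st u))
        ∂(roundLaw k)
      ≤ potential q N X K st := by
  refine le_inf (le_iInf fun h => lintegral_step_election hq X K hN h) ?_
  refine le_iInf fun l => le_iInf fun tc => le_iInf fun o => le_iInf fun j => le_iInf fun p =>
    le_iInf fun h => ?_
  rcases Nat.even_or_odd tc with ht | ht
  · refine (lintegral_mono fun u => step_even_le N K hX h ht).trans ?_
    rw [lintegral_const, measure_univ, mul_one]
  · exact lintegral_step_odd N X hK h ht

end Potential

/-! ### Measurability, independence and telescoping. -/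

section Countability

instance : Countable Message := by
  refine Function.Injective.countable (f := fun m : Message => match m with
    | .packet => (0 : ℕ) | .dmode => 1 | .anybody => 2) fun a b h => ?_
  cases a <;> cases b <;> simp_all

instance : Countable Saw := by
  refine Function.Injective.countable
    (f := fun s : Saw => (s.outer, s.inner, s.pos, s.choice)) fun a b h => ?_
  cases a; cases b; simp_all

instance : Countable Station := by
  refine Function.Injective.countable (β := ℕ × ℕ × Bool × Option Saw) (f := fun s => match s with
    | .asleep => (0, 0, false, none)
    | .wait j b => (1, j, b, none)
    | .elect i => (2, i, false, none)
    | .lead t => (3, t, false, none)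
    | .member t s => (4, t, false, some s)
    | .off => (5, 0, false, none)) fun a b h => ?_
  cases a <;> cases b <;> simp_all

instance (k : ℕ) : Countable (Snapshot k) := by
  refine Function.Injective.countable (f := fun s : Snapshot k => (s.sent, s.state))
    fun a b h => ?_
  cases a; cases b; simp_all

/-- All sets of histories are measurable. -/
instance (k : ℕ) : MeasurableSpace (List (Snapshot k)) := ⊤

instance (k : ℕ) : DiscreteMeasurableSpace (List (Snapshot k)) := ⟨fun _ => trivial⟩

end Countability

section Measurability

variable {k : ℕ}

/-- The information about a random number that determines the behaviour of a station in state
`s`. -/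
noncomputable def Station.outcome (q : ℝ) (s : Station) (x : unitInterval) : Prop × ℕ :=
  match s with
  | .elect i => ((x : ℝ) < q / (2 * q + i), 0)
  | .member _ s => (True, slotOf s.inner x)
  | _ => (True, 0)

lemma Station.measurable_outcome (q : ℝ) (s : Station) : Measurable (s.outcome q) := by
  cases s with
  | elect i =>
    exact Measurable.prodMk
      (measurableSet_setOfPred.1 (measurableSet_lt measurable_subtype_coe measurable_const))
      measurable_const
  | member t s => exact measurable_const.prodMk (measurable_slotOf _)
  | _ => exact measurable_const

lemma Saw.draw_eq_of_slotOf_eq {s : Saw} {x y : unitInterval}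
    (h : slotOf s.inner x = slotOf s.inner y) : s.draw x = s.draw y := by
  unfold slotOf at h
  unfold Saw.draw
  rw [h]

lemma Station.send_eq_of_outcome_eq {q : ℝ} {s : Station} {x y : unitInterval}
    (h : s.outcome q x = s.outcome q y) : s.send q x = s.send q y := by
  cases s with
  | elect i =>
    simp only [outcome, Prod.mk.injEq, and_true] at h
    simp only [send]
    congr 1
  | member t s =>
    simp only [outcome, Prod.mk.injEq, true_and] at h
    simp only [send, Saw.draw_eq_of_slotOf_eq h]
  | _ => rfl

lemma Station.next_eq_of_outcome_eq {q : ℝ} {s : Station} {x y : unitInterval}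
    (h : s.outcome q x = s.outcome q y) (f : Feedback) : s.next x f = s.next y f := by
  cases s with
  | member t s =>
    simp only [outcome, Prod.mk.injEq, true_and] at h
    cases f <;> simp only [next, Saw.draw_eq_of_slotOf_eq h]
  | wait j b =>
    cases f with
    | received m => cases m <;> rfl
    | _ => rfl
  | _ => cases f <;> rfl

lemma playRound_eq_of_outcome_eq {q : ℝ} {adv : Adversary k} {h : List (Snapshot k)}
    {u u' : Fin k → unitInterval}
    (huu' : (fun v => (currentState h v).outcome q (u v))
      = fun v => (currentState h v).outcome q (u' v)) :
    playRound q adv u h = playRound q adv u' h := by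
  have h1 : sentFrom q (currentState h) u = sentFrom q (currentState h) u' :=
    funext fun v => Station.send_eq_of_outcome_eq (congrFun huu' v)
  have h2 : stepStates q (adv h) (currentState h) u = stepStates q (adv h) (currentState h) u' := by
    funext v
    by_cases hv : currentState h v = .asleep
    · simp only [stepStates, hv]
    · rw [stepStates_of_ne_asleep _ _ _ _ hv, stepStates_of_ne_asleep _ _ _ _ hv, h1,
        Station.next_eq_of_outcome_eq (congrFun huu' v)]
  rw [playRound_eq, playRound_eq, h1, h2]

/-- Every function of the record of a round is measurable in the random numbers of the round. -/
lemma measurable_comp_playRound {β : Type*} [MeasurableSpace β] (q : ℝ) (adv : Adversary k)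
    (h : List (Snapshot k)) (g : Snapshot k → β) : Measurable fun u => g (playRound q adv u h) := by
  have h1 : Measurable fun (u : Fin k → unitInterval) v => (currentState h v).outcome q (u v) :=
    measurable_pi_lambda _ fun v =>
      ((currentState h v).measurable_outcome q).comp (measurable_pi_apply v)
  intro B _
  have h2 : (fun u => g (playRound q adv u h)) ⁻¹' B
      = (fun (u : Fin k → unitInterval) v => (currentState h v).outcome q (u v)) ⁻¹'
        ((fun (u : Fin k → unitInterval) v => (currentState h v).outcome q (u v)) ''
          ((fun u => g (playRound q adv u h)) ⁻¹' B)) := by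
    refine Set.Subset.antisymm (Set.subset_preimage_image _ _) ?_
    rintro u ⟨u', hu', huu'⟩
    rw [Set.mem_preimage, ← playRound_eq_of_outcome_eq huu']
    exact hu'
  rw [h2]
  -- Outcomes form a countable discrete space, so the image is measurable whatever `B` is.
  exact h1 (MeasurableSet.of_discrete)

lemma measurable_history (q : ℝ) (adv : Adversary k) (t : ℕ) :
    Measurable fun ω : ℕ → Fin k → unitInterval => history q adv ω t := by
  induction t with
  | zero => exact measurable_const
  | succ t ih =>
    have h1 : Measurable fun x : List (Snapshot k) × (Fin k → unitInterval) =>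
        playRound q adv x.2 x.1 :: x.1 :=
      measurable_from_prod_countable_right fun h =>
        measurable_comp_playRound q adv h fun s => s :: h
    exact h1.comp (ih.prodMk (measurable_pi_apply t))

lemma history_congr (q : ℝ) (adv : Adversary k) {ω ω' : ℕ → Fin k → unitInterval} {t : ℕ}
    (h : ∀ i < t, ω i = ω' i) : history q adv ω t = history q adv ω' t := by
  induction t with
  | zero => rfl
  | succ t ih => rw [history, history, ih fun i hi => h i (by omega), h t (by omega)]

instance (k : ℕ) : IsProbabilityMeasure (coinLaw k) := by
  unfold coinLaw; infer_instance

/-- The random numbers of a round are independent of the history. -/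
lemma map_history_prodMk (q : ℝ) (adv : Adversary k) (t : ℕ) :
    (coinLaw k).map (fun ω => (history q adv ω t, ω t))
      = ((coinLaw k).map fun ω => history q adv ω t).prod (roundLaw k) := by
  have hind : ProbabilityTheory.iIndepFun
      (fun (i : ℕ) (ω : ℕ → Fin k → unitInterval) => ω i) (coinLaw k) :=
    ProbabilityTheory.iIndepFun_infinitePi (P := fun _ : ℕ => roundLaw k)
      (X := fun _ x => x) fun _ => measurable_id
  have h1 := hind.indepFun_finset (Finset.range t) {t} (by simp) fun i => measurable_pi_apply i
  -- The history before round `t` depends on the first `t` coordinates only; the filler `0` for the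
  -- others is irrelevant by `history_congr`.
  let ext : ((i : Finset.range t) → Fin k → unitInterval) → ℕ → Fin k → unitInterval :=
    fun x i => if hi : i ∈ Finset.range t then x ⟨i, hi⟩ else fun _ => 0
  have hext : Measurable ext := by
    refine measurable_pi_lambda _ fun i => ?_
    by_cases hi : i ∈ Finset.range t
    · simp only [ext, hi, dif_pos]
      exact measurable_pi_apply _
    · simp only [ext, hi, dif_neg, not_false_eq_true]
      exact measurable_const
  have h2 := h1.comp ((measurable_history q adv t).comp hext)
    (measurable_pi_apply (⟨t, Finset.mem_singleton_self t⟩ : ({t} : Finset ℕ)))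
  have h3 : ((fun ω => history q adv ω t) ∘ ext) ∘
      (fun (ω : ℕ → Fin k → unitInterval) (i : Finset.range t) => ω i)
      = fun ω => history q adv ω t := by
    funext ω
    refine history_congr q adv fun i hi => ?_
    simp [ext, hi]
  rw [h3] at h2
  have h4 := h2.map_prod_eq_prod_map_map (measurable_history q adv t).aemeasurable
    (measurable_pi_apply t).aemeasurable
  have h5 : (coinLaw k).map (fun ω => ω t) = roundLaw k :=
    Measure.infinitePi_map_eval (fun _ : ℕ => roundLaw k) t
  rw [← h5]
  exact h4

lemma lintegral_history_succ (q : ℝ) (adv : Adversary k) (t : ℕ)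
    (g : List (Snapshot k) → Snapshot k → ℝ≥0∞) :
    ∫⁻ ω, g (history q adv ω t) (playRound q adv (ω t) (history q adv ω t)) ∂(coinLaw k)
      = ∫⁻ ω, ∫⁻ u, g (history q adv ω t) (playRound q adv u (history q adv ω t)) ∂(roundLaw k)
          ∂(coinLaw k) := by
  have hg : Measurable fun x : List (Snapshot k) × (Fin k → unitInterval) =>
      g x.1 (playRound q adv x.2 x.1) :=
    measurable_from_prod_countable_right fun h => measurable_comp_playRound q adv h (g h)
  have h1 := measurable_history q adv t
  calc _ = ∫⁻ x, g x.1 (playRound q adv x.2 x.1)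
        ∂((coinLaw k).map fun ω => (history q adv ω t, ω t)) :=
        (lintegral_map hg (h1.prodMk (measurable_pi_apply t))).symm
    _ = ∫⁻ h, ∫⁻ u, g h (playRound q adv u h) ∂(roundLaw k)
          ∂((coinLaw k).map fun ω => history q adv ω t) := by
        rw [map_history_prodMk, lintegral_prod _ hg.aemeasurable]
    _ = _ := lintegral_map (Measurable.of_discrete) h1

lemma measurable_attempts (q : ℝ) (adv : Adversary k) (t : ℕ) :
    Measurable fun ω => (attempts q adv ω t : ℝ≥0∞) := by
  have h1 : Measurable fun x : List (Snapshot k) × (Fin k → unitInterval) =>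
      ((transmitters (playRound q adv x.2 x.1).sent).card : ℝ≥0∞) :=
    measurable_from_prod_countable_right fun h =>
      measurable_comp_playRound q adv h fun s => ((transmitters s.sent).card : ℝ≥0∞)
  have h2 := h1.comp ((measurable_history q adv t).prodMk (measurable_pi_apply t))
  simp only [Function.comp_def] at h2
  unfold attempts
  exact h2

/-- A potential that decreases in expectation by the number of transmissions of a round bounds the
expected number of all transmissions. -/
lemma expectedAttempts_le_of_potential (q : ℝ) (adv : Adversary k)
    (F : (Fin k → Station) → ℝ≥0∞)
    (hF : ∀ (A : Finset (Fin k)) (st : Fin k → Station),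
      ∫⁻ u, ((transmitters (sentFrom q st u)).card + F (stepStates q A st u)) ∂(roundLaw k)
        ≤ F st) :
    expectedAttempts q adv ≤ F fun _ => .asleep := by
  have hstep : ∀ t, ∫⁻ ω, (attempts q adv ω t : ℝ≥0∞) ∂(coinLaw k)
      + ∫⁻ ω, F (currentState (history q adv ω (t + 1))) ∂(coinLaw k)
      ≤ ∫⁻ ω, F (currentState (history q adv ω t)) ∂(coinLaw k) := fun t => by
    rw [← lintegral_add_left (measurable_attempts q adv t)]
    have h1 := lintegral_history_succ q adv t fun _ s => (transmitters s.sent).card + F s.state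
    refine h1.le.trans (lintegral_mono fun ω => ?_)
    exact hF (adv (history q adv ω t)) (currentState (history q adv ω t))
  have hsum : ∀ n, ∑ t ∈ Finset.range n, ∫⁻ ω, (attempts q adv ω t : ℝ≥0∞) ∂(coinLaw k)
      + ∫⁻ ω, F (currentState (history q adv ω n)) ∂(coinLaw k) ≤ F fun _ => .asleep := fun n => by
    induction n with
    | zero =>
      rw [Finset.sum_range_zero, zero_add]
      change ∫⁻ _, F (fun _ => .asleep) ∂(coinLaw k) ≤ _
      rw [lintegral_const, measure_univ, mul_one]
    | succ n ih =>
      rw [Finset.sum_range_succ, add_assoc]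
      exact (add_le_add_right (hstep n) _).trans ih
  rw [expectedAttempts]
  simp only [totalAttempts]
  rw [lintegral_tsum fun t => (measurable_attempts q adv t).aemeasurable,
    ENNReal.tsum_eq_iSup_nat]
  exact iSup_le fun n => le_self_add.trans (hsum n)

end Measurability

/-! ### Choice of the parameters and final estimates. -/

/-- This fixes `K = 2 * L + 10`: with `o = L + m`, the factor `2 ^ L` covers `k`, and `m ≥ L + 10`
lets `14 * 2 ^ m` exceed the linear factor. -/
lemma mul_add_le_two_pow {k L o : ℕ} (hk : k ≤ 2 ^ L) (ho : 2 * L + 10 ≤ o) :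
    k * (o + 113) ≤ 14 * 2 ^ o := by
  obtain ⟨m, rfl⟩ := Nat.exists_eq_add_of_le (show L ≤ o by omega)
  have h1 : m < 2 ^ m := Nat.lt_two_pow_self
  have h2 : 2 ^ 10 ≤ 2 ^ m := Nat.pow_le_pow_right (by norm_num) (by omega)
  calc k * (L + m + 113) ≤ 2 ^ L * (14 * 2 ^ m) := Nat.mul_le_mul hk (by omega)
    _ = 14 * 2 ^ (L + m) := by rw [pow_add]; ring

lemma mul_electProb_le {q : ℝ} (hq : 0 < q) (k : ℕ) :
    k * electProb q ⌈4 * q * k⌉₊ ≤ 4⁻¹ := by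
  have h1 : 4 * q * k ≤ ⌈4 * q * k⌉₊ := Nat.le_ceil _
  set N := ⌈4 * q * k⌉₊
  have h2 : (0 : ℝ) < 2 * q + N := by positivity
  have h3 : (k : ℝ) * (q / (2 * q + N)) ≤ 4⁻¹ := by
    rw [← mul_div_assoc, div_le_iff₀ h2]
    linarith
  calc (k : ℝ≥0∞) * electProb q N = ENNReal.ofReal (k * (q / (2 * q + N))) := by
        rw [ENNReal.ofReal_mul (Nat.cast_nonneg k), ENNReal.ofReal_natCast, electProb]
    _ ≤ ENNReal.ofReal 4⁻¹ := ENNReal.ofReal_le_ofReal h3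
    _ = 4⁻¹ := by rw [ENNReal.ofReal_inv_of_pos (by norm_num), ENNReal.ofReal_ofNat]

/-- The term `i = 0` is exactly `1/2`; the others are below `q / i` and sum to at most `q` times a
harmonic number. -/
lemma electReserve_le {q : ℝ} (hq : 0 < q) (n : ℕ) :
    electReserve q (n + 1) 0 ≤ ENNReal.ofReal (1 / 2 + q * (1 + Real.log n)) := by
  rw [electReserve, ← Finset.range_eq_Ico]
  simp only [electProb]
  rw [← ENNReal.ofReal_sum_of_nonneg fun i _ => by positivity]
  refine ENNReal.ofReal_le_ofReal ?_
  rw [Finset.sum_range_succ', add_comm]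
  have h1 : ∑ i ∈ Finset.range n, q / (2 * q + (i + 1 : ℕ)) ≤ q * (harmonic n : ℝ) := by
    rw [harmonic, Rat.cast_sum, Finset.mul_sum]
    refine Finset.sum_le_sum fun i _ => ?_
    push_cast
    rw [div_eq_mul_inv]
    exact mul_le_mul_of_nonneg_left (inv_anti₀ (by positivity) (by linarith)) hq.le
  have h2 := mul_le_mul_of_nonneg_left (harmonic_le_one_add_log n) hq.le
  have h3 : q / (2 * q + (0 : ℕ)) = 1 / 2 := by
    rw [Nat.cast_zero, add_zero]; field_simp
  rw [h3]
  linarith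

lemma clog_le_three_mul_log {k : ℕ} (hk : 2 ≤ k) : (Nat.clog 2 k : ℝ) ≤ 3 * Real.log k := by
  have h1 : Nat.clog 2 k ≤ Nat.log 2 k + 1 := by
    refine Nat.clog_le_of_le_pow (Nat.lt_pow_succ_log_self (by norm_num) k).le
  have h2 : (2 : ℝ) ^ Nat.log 2 k ≤ k := by
    exact_mod_cast Nat.pow_log_le_self 2 (show k ≠ 0 by omega)
  have h3 := Real.log_le_log (by positivity) h2
  rw [Real.log_pow] at h3
  have h4 : (2 : ℝ) ≤ k := by exact_mod_cast hk
  have h5 := Real.log_le_log (by positivity) h4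
  have h6 := Real.log_two_gt_d9
  have h7 : (Nat.clog 2 k : ℝ) ≤ Nat.log 2 k + 1 := by exact_mod_cast h1
  have h8 : (0 : ℝ) ≤ Nat.log 2 k := Nat.cast_nonneg _
  nlinarith

lemma reserves_le {q : ℝ} (hq : 0 < q) {k : ℕ} (hk : 2 ≤ k) :
    ((100 + Nat.clog 2 k + (2 * Nat.clog 2 k + 10) * (2 * Nat.clog 2 k + 10 + 113) : ℕ) : ℝ≥0∞)
        + 2 + 2 * electReserve q ⌈4 * q * k⌉₊ 0
      ≤ ENNReal.ofReal ((6002 + 6 * q * (1 + Real.log (4 * q + 1)) + 6 * q) * Real.log k ^ 2) := by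
  have hL := clog_le_three_mul_log hk
  set L := Nat.clog 2 k
  set x := Real.log k with hx
  have hk2 : (2 : ℝ) ≤ k := by exact_mod_cast hk
  have hx0 : 2 / 3 ≤ x := by
    have := Real.log_le_log (by positivity) hk2
    linarith [Real.log_two_gt_d9]
  have hxx : x ≤ 3 / 2 * x ^ 2 := by nlinarith
  have h1x : 1 ≤ 3 * x ^ 2 := by nlinarith
  have hN0 : 0 < ⌈4 * q * k⌉₊ := Nat.ceil_pos.2 (by positivity)
  have hN1 : ((⌈4 * q * k⌉₊ : ℕ) : ℝ) < 4 * q * k + 1 := Nat.ceil_lt_add_one (by positivity)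
  obtain ⟨n, hn⟩ := Nat.exists_eq_succ_of_ne_zero hN0.ne'
  rw [Nat.succ_eq_add_one] at hn
  rw [hn] at hN1 ⊢
  push_cast at hN1
  have hlog4 : 0 ≤ Real.log (4 * q + 1) := Real.log_nonneg (by linarith)
  have hlogn : Real.log n ≤ Real.log (4 * q + 1) + x := by
    rcases Nat.eq_zero_or_pos n with rfl | h0
    · simp only [Nat.cast_zero, Real.log_zero]; linarith
    · rw [hx, ← Real.log_mul (by positivity) (by positivity)]
      exact Real.log_le_log (by exact_mod_cast h0) (by nlinarith)
  have hE := electReserve_le hq n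
  have hc : ((100 + L + (2 * L + 10) * (2 * L + 10 + 113) : ℕ) : ℝ≥0∞) + 2
      = ENNReal.ofReal (((100 + L + (2 * L + 10) * (2 * L + 10 + 113) : ℕ) : ℝ) + 2) := by
    rw [ENNReal.ofReal_add (Nat.cast_nonneg _) (by norm_num), ENNReal.ofReal_natCast,
      ENNReal.ofReal_ofNat]
  have hlogn0 : 0 ≤ Real.log n := Real.log_natCast_nonneg n
  calc _ ≤ ENNReal.ofReal (((100 + L + (2 * L + 10) * (2 * L + 10 + 113) : ℕ) : ℝ) + 2)
        + 2 * ENNReal.ofReal (1 / 2 + q * (1 + Real.log n)) := by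
        rw [hc]; gcongr
    _ = ENNReal.ofReal ((((100 + L + (2 * L + 10) * (2 * L + 10 + 113) : ℕ) : ℝ) + 2)
        + 2 * (1 / 2 + q * (1 + Real.log n))) := by
        rw [ENNReal.ofReal_add (p := _ + 2) (by positivity) (by positivity),
          ENNReal.ofReal_mul (by norm_num), ENNReal.ofReal_ofNat]
    _ ≤ _ := by
        refine ENNReal.ofReal_le_ofReal ?_
        push_cast
        have hL0 : (0 : ℝ) ≤ L := Nat.cast_nonneg _
        have hL2 : (L : ℝ) ^ 2 ≤ 9 * x ^ 2 := by nlinarith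
        -- The `3` collects the `2` of the weight and twice the `1/2` from iteration `0`.
        have h1 : 100 + (L : ℝ) + (2 * L + 10) * (2 * L + 10 + 113) + 3 ≤ 6002 * x ^ 2 := by
          nlinarith
        have h2 : q * (1 + Real.log n) ≤ q * (1 + Real.log (4 * q + 1)) + q * x := by
          nlinarith
        have h3 : q * x ≤ q * (3 / 2 * x ^ 2) := by gcongr
        have h4 : q * (1 + Real.log (4 * q + 1)) * 1
            ≤ q * (1 + Real.log (4 * q + 1)) * (3 * x ^ 2) := by gcongr
        have h5 : 0 ≤ q * x ^ 2 := by positivity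
        linarith

theorem theorem6p4 (q : ℝ) (hq : 0 < q) :
    ∃ C : ℝ, ∀ k : ℕ, 2 ≤ k → ∀ adv : Adversary k,
      expectedAttempts q adv ≤ ENNReal.ofReal (C * (k * Real.log k ^ 2)) := by
  refine ⟨6002 + 6 * q * (1 + Real.log (4 * q + 1)) + 6 * q, fun k hk adv => ?_⟩
  set L := Nat.clog 2 k with hL
  have hkL : k ≤ 2 ^ L := Nat.le_pow_clog (by norm_num) k
  -- The cut-off `⌈4qk⌉` makes late transmissions sum to at most `1/4`, `2 ^ L` dominates `k`, and
  -- `2 * L + 10` passes suffice for the reserve.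
  have h1 := expectedAttempts_le_of_potential q adv
    (potential q ⌈4 * q * k⌉₊ L (2 * L + 10))
    (lintegral_step_le hq (mul_electProb_le hq k) hkL fun o ho => mul_add_le_two_pow hkL ho)
  have h2 : IsElection fun _ : Fin k => Station.asleep := fun v => by simp
  refine h1.trans ((potential_le_of_isElection _ _ _ h2).trans ?_)
  simp only [weight, Finset.sum_const, Finset.card_univ, Fintype.card_fin, nsmul_eq_mul]
  calc _ ≤ (k : ℝ≥0∞) * ENNReal.ofReal
        ((6002 + 6 * q * (1 + Real.log (4 * q + 1)) + 6 * q) * Real.log k ^ 2) := by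
        gcongr
        exact reserves_le hq hk
    _ = _ := by
        rw [← ENNReal.ofReal_natCast, ← ENNReal.ofReal_mul (Nat.cast_nonneg k)]
        congr 1
        ring
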